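/- Rings are unital, not necessarily commutative, and ring homomorphisms preserve units. Let $\iota\colon N\to M$ be a ring homomorphism; regard $M$ as an $N$-$N$-bimodule via $\iota$. The extension is *left D2* if, as an $N$-$M$-bimodule, $M\otimes_N M$ is isomorphic to a direct summand of $M^n$ for some $n\ge 1$; it is *right D2* if, as an $M$-$N$-bimodule, $M\otimes_N M$ is isomorphic to a direct summand of $M^m$ for some $m\ge1$; it is *D2* if both hold. Put $R=C_M(N)=\{r\in M: rn=nr\ \forall n\in N\}$, $A=\mathrm{End}({}_NM_N)$, and $B=(M\otimes_N M)^N=\{b: nb=bn\ \forall n\in N\}$. Write $b=b^1\otimes b^2$ (summation suppressed). $B$ is a ring with product $bb'=b'^1b^1\otimes b^2b'^2$ and unit $1\otimes1$. Let $s_B\colon R\to B$, $s_B(r)=1\otimes r$, and $t_B\colon R^{op}\to B$, $t_B(r)=r\otimes 1$; $B$ is an $R$-$R$-bimodule via $r\cdot b\cdot r'=b\,t_B(r)s_B(r')=rb^1\otimes b^2r'$. A *right bialgebroid* over a ring $R$ is a ring $B$ with ring homomorphisms $s\colon R\to B$, $t\colon R^{op}\to B$ with commuting images, making $B$ an $R$-$R$-bimodule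 by $r\cdot b\cdot r'=bt(r)s(r')$, and with $R$-$R$-bimodule maps $\Delta\colon B\to B\otimes_RB$, $\varepsilon\colon B\to R$, such that: $\Delta$ is coassociative with counit $\varepsilon$; $\Delta$ is a ring homomorphism into the ring $B\times_RB=\{X\in B\otimes_RB: (s(r)\otimes1)X=(1\otimes t(r))X\ \forall r\in R\}$ with factorwise multiplication; $\varepsilon(1)=1$; and $\varepsilon(t(\varepsilon(a))b)=\varepsilon(ab)=\varepsilon(s(\varepsilon(a))b)$ for all $a,b\in B$. A *right module algebroid* over it is a ring $X$ (with unit $1_X$) with a right $B$-module structure $\triangleleft$ such that, for the induced bimodule structure $r\cdot x\cdot r'=x\triangleleft t(r)s(r')$, the multiplication is an $R$-$R$-bimodule map $X\otimes_RX\to X$, $r\cdot1_X=1_X\cdot r$, $(xy)\triangleleft b=(x\triangleleft b_{(1)})(y\triangleleft b_{(2)})$ and $1_X\triangleleft b=1_X\cdot\varepsilon(b)$; its *invariants* are the $x\in X$ with $x\triangleleft b=x\triangleleft s(\varepsilon(b))$ for all $b\in B$. **Theorem.** Let $\iota\colon N\to M$ be a D2 extension of rings. Then: 1. The map $\imath\colon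 B\otimes_RB\to(M\otimes_NM\otimes_NM)^N$, $b\otimes b'\mapsto b^1\otimes b^2b'^1\otimes b'^2$, is a well-defined isomorphism of $R$-$R$-bimodules (with $r\cdot(m\otimes m'\otimes m'')\cdot r'=rm\otimes m'\otimes m''r'$). 2. $\langle B,R,s_B,t_B,\Delta_B,\varepsilon_B\rangle$ is a right bialgebroid, where $\Delta_B(b)=\imath^{-1}(b^1\otimes1\otimes b^2)$ and $\varepsilon_B(b)=b^1b^2$. Moreover there exist finite families $b_i\in B$, $\beta_i\in A$ with $\sum_i b_i^1\otimes b_i^2\beta_i(m)=m\otimes1$ for all $m\in M$, and for each such pair of families $\Delta_B(b)=\sum_i b_i\otimes_R(\beta_i(b^1)\otimes b^2)$ for all $b\in B$. 3. The ring $\mathrm{End}({}_NM)$ of left $N$-linear endomorphisms of $M$ (with composition) is a right $B$-module algebroid with respect to $\xi\triangleleft b=b^1\xi(b^2\,-)$, and its subring of invariants is exactly $\rho(M)$, the set of right multiplications $x\mapsto xm$, $m\in M$. -/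

import Mathlib

open scoped TensorProduct
open MulOpposite

namespace DepthTwo

/-! ### Tensor products over a noncommutative ring -/

section BalTensor

variable {R X Y Z X' Y' : Type*} [AddCommGroup X] [AddCommGroup Y] [AddCommGroup Z]
  [AddCommGroup X'] [AddCommGroup Y']

/-- The subgroup of `X ⊗[ℤ] Y` generated by all `x·r ⊗ y - x ⊗ r·y`. -/
def balRel (ra : R → X →+ X) (la : R → Y →+ Y) : AddSubgroup (X ⊗[ℤ] Y) :=
  AddSubgroup.closure {z | ∃ r x y, z = (ra r x) ⊗ₜ[ℤ] y - x ⊗ₜ[ℤ] (la r y)}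

/-- The tensor product `X ⊗_R Y` of a right `R`-module `X` and a left `R`-module `Y` over a
not necessarily commutative ring `R`. The two module structures are given by their actions
`ra r x = x·r` and `la r y = r·y`. -/
def BalTensor (ra : R → X →+ X) (la : R → Y →+ Y) : Type _ :=
  (X ⊗[ℤ] Y) ⧸ balRel ra la

namespace BalTensor

variable {ra : R → X →+ X} {la : R → Y →+ Y} {ra' : R → X' →+ X'} {la' : R → Y' →+ Y'}

instance : AddCommGroup (BalTensor ra la) :=
  inferInstanceAs (AddCommGroup ((X ⊗[ℤ] Y) ⧸ balRel ra la))

/-- The pure tensor `x ⊗_R y`. -/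
def tmul (ra : R → X →+ X) (la : R → Y →+ Y) (x : X) (y : Y) : BalTensor ra la :=
  QuotientAddGroup.mk' (balRel ra la) (x ⊗ₜ[ℤ] y)

theorem add_tmul (x x' : X) (y : Y) :
    tmul ra la (x + x') y = tmul ra la x y + tmul ra la x' y := by
  simp only [tmul, TensorProduct.add_tmul]
  exact map_add (QuotientAddGroup.mk' (balRel ra la)) _ _

theorem tmul_add (x : X) (y y' : Y) :
    tmul ra la x (y + y') = tmul ra la x y + tmul ra la x y' := by
  simp only [tmul, TensorProduct.tmul_add]
  exact map_add (QuotientAddGroup.mk' (balRel ra la)) _ _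

theorem tmul_bal (r : R) (x : X) (y : Y) :
    tmul ra la (ra r x) y = tmul ra la x (la r y) := by
  refine (QuotientAddGroup.eq_iff_sub_mem).2 ?_
  exact AddSubgroup.subset_closure ⟨r, x, y, rfl⟩

/-- The additive map `x ⊗ y ↦ f x y` induced by a biadditive `R`-balanced `f`. -/
def lift (f : X → Y → Z) (h₁ : ∀ x x' y, f (x + x') y = f x y + f x' y)
    (h₂ : ∀ x y y', f x (y + y') = f x y + f x y')
    (h₃ : ∀ r x y, f (ra r x) y = f x (la r y)) : BalTensor ra la →+ Z :=
  QuotientAddGroup.lift (balRel ra la)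
    (TensorProduct.liftAddHom
      (AddMonoidHom.mk' (fun x => AddMonoidHom.mk' (f x) (h₂ x))
        (fun x x' => AddMonoidHom.ext (h₁ x x')))
      (fun n x y => by
        refine DFunLike.congr_fun (f := AddMonoidHom.mk' (f (n • x)) (h₂ (n • x)))
          (g := (AddMonoidHom.mk' (f x) (h₂ x)).comp (zsmulAddGroupHom n)) ?_ y
        have h := map_zsmul (AddMonoidHom.mk' (fun x => AddMonoidHom.mk' (f x) (h₂ x))
          (fun x x' => AddMonoidHom.ext (h₁ x x')) : X →+ Y →+ Z) n x
        refine h.trans (AddMonoidHom.ext fun y => ?_)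
        exact (map_zsmul (AddMonoidHom.mk' (f x) (h₂ x)) n y).symm)) (by
    refine (AddSubgroup.closure_le _).2 ?_
    rintro _ ⟨r, x, y, rfl⟩
    refine (map_sub _ _ _).trans (sub_eq_zero.2 ?_)
    exact h₃ r x y)

@[simp] theorem lift_tmul (f : X → Y → Z) (h₁ h₂) (h₃ : ∀ r x y, f (ra r x) y = f x (la r y))
    (x : X) (y : Y) : lift f h₁ h₂ h₃ (tmul ra la x y) = f x y := rfl

theorem induction {p : BalTensor ra la → Prop} (h₀ : p 0) (ht : ∀ x y, p (tmul ra la x y))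
    (ha : ∀ u v, p u → p v → p (u + v)) (u : BalTensor ra la) : p u := by
  obtain ⟨z, rfl⟩ := QuotientAddGroup.mk'_surjective (balRel ra la) u
  induction z using TensorProduct.induction_on with
  | zero => exact h₀
  | tmul x y => exact ht x y
  | add a b ha' hb' => exact (map_add (QuotientAddGroup.mk' (balRel ra la)) a b) ▸ ha _ _ ha' hb'

theorem hom_ext {f g : BalTensor ra la →+ Z}
    (h : ∀ x y, f (tmul ra la x y) = g (tmul ra la x y)) : f = g := by
  ext u
  induction u using induction with
  | h₀ => simp
  | ht x y => exact h x y
  | ha u v hu hv => simp [hu, hv]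

/-- The map `f ⊗ g` for a right `R`-linear `f` and a left `R`-linear `g`. -/
def map (f : X →+ X') (g : Y →+ Y') (hf : ∀ r x, f (ra r x) = ra' r (f x))
    (hg : ∀ r y, g (la r y) = la' r (g y)) : BalTensor ra la →+ BalTensor ra' la' :=
  lift (fun x y => tmul ra' la' (f x) (g y))
    (fun x x' y => by simp [add_tmul]) (fun x y y' => by simp [tmul_add])
    (fun r x y => by simp only [hf, hg, tmul_bal])

@[simp] theorem map_tmul (f : X →+ X') (g : Y →+ Y') (hf : ∀ r x, f (ra r x) = ra' r (f x))
    (hg : ∀ r y, g (la r y) = la' r (g y)) (x : X) (y : Y) :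
    map f g hf hg (tmul ra la x y) = tmul ra' la' (f x) (g y) := rfl

end BalTensor

end BalTensor

/-! ### Right bialgebroids -/

section Bialgebroid

/-- A ring `A` with ring homomorphisms `s : R → A` and `t : Rᵒᵖ → A` whose images commute.
It makes `A` an `R`-`R`-bimodule through `r·a·r' = a t(r) s(r')`. -/
structure SourceTarget (R A : Type*) [Ring R] [Ring A] where
  s : R →+* A
  t : Rᵐᵒᵖ →+* A
  comm : ∀ r r' : R, s r * t (op r') = t (op r') * s r

namespace SourceTarget

variable {R A : Type*} [Ring R] [Ring A] (st : SourceTarget R A)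

/-- The right `R`-action `a·r = a s(r)`. -/
def ra (r : R) : A →+ A := AddMonoidHom.mulRight (st.s r)

/-- The left `R`-action `r·a = a t(r)`. -/
def la (r : R) : A →+ A := AddMonoidHom.mulRight (st.t (op r))

@[simp] theorem ra_apply (r : R) (a : A) : st.ra r a = a * st.s r := rfl

@[simp] theorem la_apply (r : R) (a : A) : st.la r a = a * st.t (op r) := rfl

theorem ra_la (r r' : R) (a : A) : st.ra r (st.la r' a) = st.la r' (st.ra r a) := by
  simp [mul_assoc, st.comm]

/-- `A ⊗_R A`. -/
abbrev Tensor : Type _ := BalTensor st.ra st.la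

/-- The left `R`-action `r·(a ⊗ a') = (r·a) ⊗ a'` on `A ⊗_R A`. -/
def tensorLa (r : R) : st.Tensor →+ st.Tensor :=
  BalTensor.map (st.la r) (AddMonoidHom.id A) (fun r' a => (st.ra_la r' r a).symm)
    (fun _ _ => rfl)

/-- The right `R`-action `(a ⊗ a')·r = a ⊗ (a'·r)` on `A ⊗_R A`. -/
def tensorRa (r : R) : st.Tensor →+ st.Tensor :=
  BalTensor.map (AddMonoidHom.id A) (st.ra r) (fun _ _ => rfl) (fun r' a => st.ra_la r r' a)

/-- `A ⊗_R (A ⊗_R A)`. -/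
abbrev Tensor₃ : Type _ := BalTensor st.ra st.tensorLa

/-- `(A ⊗_R A) ⊗_R A`. -/
abbrev Tensor₃' : Type _ := BalTensor st.tensorRa st.la

/-- The canonical map `(A ⊗_R A) ⊗_R A → A ⊗_R (A ⊗_R A)`,
`(a ⊗ a') ⊗ a'' ↦ a ⊗ (a' ⊗ a'')`. -/
def assoc : st.Tensor₃' →+ st.Tensor₃ :=
  BalTensor.lift
    (fun x a'' =>
      (BalTensor.lift
        (fun a a' => BalTensor.tmul st.ra st.tensorLa a (BalTensor.tmul st.ra st.la a' a''))
        (fun _ _ _ => BalTensor.add_tmul _ _ _)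
        (fun _ _ _ => by rw [BalTensor.add_tmul, BalTensor.tmul_add])
        (fun _ _ _ => BalTensor.tmul_bal _ _ _) : st.Tensor →+ st.Tensor₃) x)
    (fun _ _ _ => map_add _ _ _)
    (fun x a a' => by
      induction x using BalTensor.induction with
      | h₀ => simp
      | ht x y =>
        change BalTensor.tmul st.ra st.tensorLa x (BalTensor.tmul st.ra st.la y (a + a')) =
          BalTensor.tmul st.ra st.tensorLa x (BalTensor.tmul st.ra st.la y a) +
            BalTensor.tmul st.ra st.tensorLa x (BalTensor.tmul st.ra st.la y a')
        rw [BalTensor.tmul_add, BalTensor.tmul_add]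
      | ha u v hu hv => simp only [map_add, hu, hv]; abel)
    (fun r x a => by
      induction x using BalTensor.induction with
      | h₀ => simp
      | ht x y =>
        change BalTensor.tmul st.ra st.tensorLa x (BalTensor.tmul st.ra st.la (st.ra r y) a) =
          BalTensor.tmul st.ra st.tensorLa x (BalTensor.tmul st.ra st.la y (st.la r a))
        rw [BalTensor.tmul_bal]
      | ha u v hu hv => simp only [map_add, hu, hv])

@[simp] theorem assoc_tmul (a a' a'' : A) :
    st.assoc (BalTensor.tmul st.tensorRa st.la (BalTensor.tmul st.ra st.la a a') a'') =
      BalTensor.tmul st.ra st.tensorLa a (BalTensor.tmul st.ra st.la a' a'') := rfl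

/-- Left multiplication `x ↦ (c ⊗ c') x` on `A ⊗_R A`, that is
`a ⊗ a' ↦ c a ⊗ c' a'`. -/
def legMul (c c' : A) : st.Tensor →+ st.Tensor :=
  BalTensor.map (AddMonoidHom.mulLeft c) (AddMonoidHom.mulLeft c')
    (fun _ _ => by simp [mul_assoc]) (fun _ _ => by simp [mul_assoc])

@[simp] theorem legMul_tmul (c c' a a' : A) :
    st.legMul c c' (BalTensor.tmul st.ra st.la a a') =
      BalTensor.tmul st.ra st.la (c * a) (c' * a') := rfl

theorem legMul_legMul (c c' d d' : A) (x : st.Tensor) :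
    st.legMul c c' (st.legMul d d' x) = st.legMul (c * d) (c' * d') x := by
  induction x using BalTensor.induction with
  | h₀ => simp
  | ht x y => simp [mul_assoc]
  | ha u v hu hv => simp only [map_add, hu, hv]

theorem legMul_one (x : st.Tensor) : st.legMul 1 1 x = x := by
  induction x using BalTensor.induction with
  | h₀ => simp
  | ht x y => simp
  | ha u v hu hv => simp only [map_add, hu, hv]

theorem legMul_add_left (c d c' : A) (x : st.Tensor) :
    st.legMul (c + d) c' x = st.legMul c c' x + st.legMul d c' x := by
  induction x using BalTensor.induction with
  | h₀ => simp
  | ht x y => simp [add_mul, BalTensor.add_tmul]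
  | ha u v hu hv => simp only [map_add, hu, hv]; abel

theorem legMul_add_right (c c' d' : A) (x : st.Tensor) :
    st.legMul c (c' + d') x = st.legMul c c' x + st.legMul c d' x := by
  induction x using BalTensor.induction with
  | h₀ => simp
  | ht x y => simp [add_mul, BalTensor.tmul_add]
  | ha u v hu hv => simp only [map_add, hu, hv]; abel

/-- The Takeuchi product
`A ×_R A = {x ∈ A ⊗_R A | (s(r) ⊗ 1) x = (1 ⊗ t(r)) x for all r}`. -/
def takeuchi : AddSubgroup st.Tensor where
  carrier := {x | ∀ r : R, st.legMul (st.s r) 1 x = st.legMul 1 (st.t (op r)) x}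
  add_mem' hx hy r := by simp only [map_add, hx r, hy r]
  zero_mem' r := by simp
  neg_mem' hx r := by simp only [map_neg, hx r]

/-- Right multiplication by `y ∈ A ×_R A` on `A ⊗_R A`: `a ⊗ a' ↦ (a ⊗ a') y`. -/
def mulT (y : st.takeuchi) : st.Tensor →+ st.Tensor :=
  BalTensor.lift (fun a a' => st.legMul a a' y)
    (fun _ _ _ => st.legMul_add_left _ _ _ _) (fun _ _ _ => st.legMul_add_right _ _ _ _)
    (fun r a a' => by
      have h := congrArg (st.legMul a a') (y.2 r)
      simpa [legMul_legMul] using h)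

@[simp] theorem mulT_tmul (y : st.takeuchi) (a a' : A) :
    st.mulT y (BalTensor.tmul st.ra st.la a a') = st.legMul a a' y := rfl

theorem mulT_legMul (y : st.takeuchi) (c c' : A) (x : st.Tensor) :
    st.mulT y (st.legMul c c' x) = st.legMul c c' (st.mulT y x) := by
  induction x using BalTensor.induction with
  | h₀ => simp
  | ht x z => simp [legMul_legMul]
  | ha u v hu hv => simp only [map_add, hu, hv]

instance : Mul st.takeuchi :=
  ⟨fun x y => ⟨st.mulT y x, fun r => by rw [← mulT_legMul, ← mulT_legMul, x.2 r]⟩⟩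

instance : One st.takeuchi :=
  ⟨⟨BalTensor.tmul st.ra st.la 1 1, fun r => by
    simpa using BalTensor.tmul_bal (ra := st.ra) (la := st.la) r (1 : A) (1 : A)⟩⟩

theorem takeuchi_coe_mul (x y : st.takeuchi) : ((x * y : st.takeuchi) : st.Tensor) = st.mulT y x :=
  rfl

theorem takeuchi_coe_one : ((1 : st.takeuchi) : st.Tensor) = BalTensor.tmul st.ra st.la 1 1 := rfl

/-- The ring `A ×_R A`, with the multiplication `(a ⊗ a')(c ⊗ c') = a c ⊗ a' c'`. -/
instance : Ring st.takeuchi :=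
  { (inferInstance : AddCommGroup st.takeuchi) with
    mul := (· * ·)
    one := 1
    mul_assoc := fun x y z => Subtype.ext <| by
      change st.mulT z (st.mulT y x) = st.mulT (y * z) x
      refine DFunLike.congr_fun (f := (st.mulT z).comp (st.mulT y)) (BalTensor.hom_ext ?_) x.1
      intro a a'
      simp [takeuchi_coe_mul, mulT_legMul]
    one_mul := fun x => Subtype.ext <| by
      change st.mulT x (BalTensor.tmul st.ra st.la 1 1) = x
      simp [legMul_one]
    mul_one := fun x => Subtype.ext <| by
      change st.mulT 1 x = x
      refine DFunLike.congr_fun (g := AddMonoidHom.id _) (BalTensor.hom_ext ?_) x.1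
      intro a a'
      simp [takeuchi_coe_one]
    zero_mul := fun x => Subtype.ext <| map_zero (st.mulT x)
    mul_zero := fun x => Subtype.ext <| by
      change st.mulT 0 x = 0
      refine DFunLike.congr_fun (g := (0 : st.Tensor →+ st.Tensor)) (BalTensor.hom_ext ?_) x.1
      intro a a'
      simp
    left_distrib := fun x y z => Subtype.ext <| by
      change st.mulT (y + z) x = st.mulT y x + st.mulT z x
      refine DFunLike.congr_fun (g := st.mulT y + st.mulT z) (BalTensor.hom_ext ?_) x.1
      intro a a'
      simp
    right_distrib := fun x y z => Subtype.ext <| map_add (st.mulT z) x.1 y.1 }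

end SourceTarget

/-- A right bialgebroid over `R` on the ring `A` with source map `st.s` and target map `st.t`:
a comonoid structure on the `R`-`R`-bimodule `A` (where `r·a·r' = a t(r) s(r')`) whose
coproduct is a ring homomorphism into `A ×_R A` and whose counit satisfies `ε(1) = 1` and
`ε(t(ε(a)) b) = ε(a b) = ε(s(ε(a)) b)`. -/
structure RightBialgebroid {R A : Type*} [Ring R] [Ring A] (st : SourceTarget R A) where
  comul : A →+* st.takeuchi
  counit : A →+ R
  comul_la : ∀ (r : R) (a : A),
    (comul (st.la r a) : st.Tensor) = st.tensorLa r (comul a : st.Tensor)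
  comul_ra : ∀ (r : R) (a : A),
    (comul (st.ra r a) : st.Tensor) = st.tensorRa r (comul a : st.Tensor)
  counit_la : ∀ (r : R) (a : A), counit (st.la r a) = r * counit a
  counit_ra : ∀ (r : R) (a : A), counit (st.ra r a) = counit a * r
  /-- `(Δ ⊗ id) ∘ Δ = (id ⊗ Δ) ∘ Δ` -/
  coassoc : ∀ a : A,
    st.assoc ((BalTensor.map (ra' := st.tensorRa) (la' := st.la)
        (st.takeuchi.subtype.comp comul.toAddMonoidHom) (AddMonoidHom.id A)
        comul_ra (fun _ _ => rfl)) (comul a : st.Tensor)) =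
      (BalTensor.map (ra' := st.ra) (la' := st.tensorLa)
        (AddMonoidHom.id A) (st.takeuchi.subtype.comp comul.toAddMonoidHom)
        (fun _ _ => rfl) comul_la) (comul a : st.Tensor)
  /-- `(ε ⊗ id) ∘ Δ = id`, i.e. `ε(a₁)·a₂ = a` -/
  counit_comul : ∀ a : A,
    (BalTensor.lift (fun a₁ a₂ => st.la (counit a₁) a₂)
      (fun _ _ _ => by simp [mul_add]) (fun _ _ _ => by simp [add_mul])
      (fun r a₁ a₂ => by
        rw [counit_ra]; simp [mul_assoc]) : st.Tensor →+ A) (comul a : st.Tensor) = a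
  /-- `(id ⊗ ε) ∘ Δ = id`, i.e. `a₁·ε(a₂) = a` -/
  comul_counit : ∀ a : A,
    (BalTensor.lift (fun a₁ a₂ => st.ra (counit a₂) a₁)
      (fun _ _ _ => by simp [add_mul]) (fun _ _ _ => by simp [mul_add])
      (fun r a₁ a₂ => by
        rw [counit_la]; simp [mul_assoc]) : st.Tensor →+ A) (comul a : st.Tensor) = a
  counit_one : counit 1 = 1
  counit_target_mul : ∀ a b : A, counit (st.t (op (counit a)) * b) = counit (a * b)
  counit_source_mul : ∀ a b : A, counit (st.s (counit a) * b) = counit (a * b)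

/-- A right `A`-module algebroid over the right bialgebroid `𝓑` on `A`, with underlying ring `X`.
The right `A`-action is `x ◁ a = act (op a) x`, and the induced `R`-`R`-bimodule structure of `X`
is `r·x = x ◁ t(r)`, `x·r = x ◁ s(r)`. -/
structure RightModuleAlgebroid {R A : Type*} [Ring R] [Ring A] {st : SourceTarget R A}
    (𝓑 : RightBialgebroid st) (X : Type*) [Ring X] where
  act : Aᵐᵒᵖ →+* AddMonoid.End X
  /-- `(x·r) y = x (r·y)`: the multiplication is defined on `X ⊗_R X` -/
  act_source_mul : ∀ (r : R) (x y : X),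
    act (op (st.s r)) x * y = x * act (op (st.t (op r))) y
  /-- `r·(x y) = (r·x) y` -/
  act_target_mul : ∀ (r : R) (x y : X),
    act (op (st.t (op r))) (x * y) = act (op (st.t (op r))) x * y
  /-- `(x y)·r = x (y·r)` -/
  mul_act_source : ∀ (r : R) (x y : X),
    act (op (st.s r)) (x * y) = x * act (op (st.s r)) y
  /-- `(x y) ◁ a = (x ◁ a₁) (y ◁ a₂)` -/
  mul_act : ∀ (a : A) (x y : X), act (op a) (x * y) =
    (BalTensor.lift (fun a₁ a₂ => act (op a₁) x * act (op a₂) y)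
      (fun _ _ _ => by
        rw [op_add, map_add]; exact add_mul _ _ _)
      (fun _ _ _ => by
        rw [op_add, map_add]; exact mul_add _ _ _)
      (fun r a₁ a₂ => by
        simpa using act_source_mul r (act (op a₁) x) (act (op a₂) y)) : st.Tensor →+ X)
      (𝓑.comul a : st.Tensor)
  /-- `r·1 = 1·r` -/
  one_act_target : ∀ r : R, act (op (st.t (op r))) 1 = act (op (st.s r)) 1
  /-- `1 ◁ a = 1·ε(a)` -/
  one_act : ∀ a : A, act (op a) 1 = act (op (st.s (𝓑.counit a))) 1

/-- The invariants `{x | x ◁ a = x ◁ s(ε(a)) for all a}`. -/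
def RightModuleAlgebroid.invariants {R A : Type*} [Ring R] [Ring A] {st : SourceTarget R A}
    {𝓑 : RightBialgebroid st} {X : Type*} [Ring X] (𝓜 : RightModuleAlgebroid 𝓑 X) : Set X :=
  {x | ∀ a : A, 𝓜.act (op a) x = 𝓜.act (op (st.s (𝓑.counit a))) x}

end Bialgebroid

/-! ### Ring extensions -/

section Extension

variable {N M : Type*} [Ring N] [Ring M] (ι : N →+* M)

/-- `M ⊗_N M` for the ring extension `ι : N → M`. -/
abbrev TSq : Type _ :=
  BalTensor (fun n : N => AddMonoidHom.mulRight (ι n)) (fun n : N => AddMonoidHom.mulLeft (ι n))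

/-- The pure tensor `x ⊗ y` in `M ⊗_N M`. -/
def tm (x y : M) : TSq ι := BalTensor.tmul _ _ x y

variable {ι} in
theorem tm_bal (n : N) (x y : M) : tm ι (x * ι n) y = tm ι x (ι n * y) :=
  BalTensor.tmul_bal (ra := fun n : N => AddMonoidHom.mulRight (ι n))
    (la := fun n : N => AddMonoidHom.mulLeft (ι n)) n x y

/-- The left `M`-action `m·(x ⊗ y) = m x ⊗ y` on `M ⊗_N M`. -/
def lmul (m : M) : TSq ι →+ TSq ι :=
  BalTensor.map (AddMonoidHom.mulLeft m) (AddMonoidHom.id M)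
    (fun _ _ => by simp [mul_assoc]) (fun _ _ => rfl)

/-- The right `M`-action `(x ⊗ y)·m = x ⊗ y m` on `M ⊗_N M`. -/
def rmul (m : M) : TSq ι →+ TSq ι :=
  BalTensor.map (AddMonoidHom.id M) (AddMonoidHom.mulRight m)
    (fun _ _ => rfl) (fun _ _ => by simp [mul_assoc])

@[simp] theorem lmul_tm (m x y : M) : lmul ι m (tm ι x y) = tm ι (m * x) y := rfl

@[simp] theorem rmul_tm (m x y : M) : rmul ι m (tm ι x y) = tm ι x (y * m) := rfl

variable {ι} in
theorem tsq_induction {p : TSq ι → Prop} (h₀ : p 0) (ht : ∀ x y, p (tm ι x y))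
    (ha : ∀ u v, p u → p v → p (u + v)) (u : TSq ι) : p u :=
  BalTensor.induction h₀ ht ha u

/-- `P` is isomorphic to a direct summand of `Q` as a bimodule; the left and right actions on
`P` and `Q` are given by `lP, rP` and `lQ, rQ`. -/
def IsBimoduleSummand {S T P Q : Type*} [AddCommGroup P] [AddCommGroup Q]
    (lP : S → P → P) (rP : T → P → P) (lQ : S → Q → Q) (rQ : T → Q → Q) : Prop :=
  ∃ (σ : P →+ Q) (W : AddSubgroup Q), Function.Injective σ ∧
    (∀ s p, σ (lP s p) = lQ s (σ p)) ∧ (∀ t p, σ (rP t p) = rQ t (σ p)) ∧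
    (∀ s, ∀ w ∈ W, lQ s w ∈ W) ∧ (∀ t, ∀ w ∈ W, rQ t w ∈ W) ∧ IsCompl σ.range W

/-- Left D2: as an `N`-`M`-bimodule, `M ⊗_N M` is isomorphic to a direct summand of `M^n` for some
`n > 0`. -/
def IsLeftD2 : Prop :=
  ∃ n : ℕ, 0 < n ∧ IsBimoduleSummand (S := N) (T := M) (P := TSq ι) (Q := Fin n → M)
    (fun a => lmul ι (ι a)) (fun m => rmul ι m)
    (fun a f i => ι a * f i) (fun m f i => f i * m)

/-- Right D2: as an `M`-`N`-bimodule, `M ⊗_N M` is isomorphic to a direct summand of `M^n` for some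
`n > 0`. -/
def IsRightD2 : Prop :=
  ∃ n : ℕ, 0 < n ∧ IsBimoduleSummand (S := M) (T := N) (P := TSq ι) (Q := Fin n → M)
    (fun m => lmul ι m) (fun a => rmul ι (ι a))
    (fun m f i => m * f i) (fun a f i => f i * ι a)

/-- A ring extension of depth two. -/
def IsD2 : Prop := IsLeftD2 ι ∧ IsRightD2 ι

/-- `R = C_M(N)`. -/
abbrev cent : Subring M := Subring.centralizer (Set.range ι)

theorem cent_comm (r : cent ι) (n : N) : ι n * (r : M) = r * ι n :=
  Subring.mem_centralizer_iff.1 r.2 _ ⟨n, rfl⟩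

/-- `B = (M ⊗_N M)^N`. -/
def tsqCent : AddSubgroup (TSq ι) where
  carrier := {b | ∀ n : N, lmul ι (ι n) b = rmul ι (ι n) b}
  add_mem' hx hy n := by simp only [map_add, hx n, hy n]
  zero_mem' n := by simp
  neg_mem' hx n := by simp only [map_neg, hx n]

theorem lmul_add (m m' : M) (x : TSq ι) : lmul ι (m + m') x = lmul ι m x + lmul ι m' x := by
  induction x using tsq_induction with
  | h₀ => simp
  | ht x y =>
    simp only [lmul_tm, add_mul]
    exact BalTensor.add_tmul _ _ _
  | ha u v hu hv => simp only [map_add, hu, hv]; abel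

theorem rmul_add (m m' : M) (x : TSq ι) : rmul ι (m + m') x = rmul ι m x + rmul ι m' x := by
  induction x using tsq_induction with
  | h₀ => simp
  | ht x y =>
    simp only [rmul_tm, mul_add]
    exact BalTensor.tmul_add _ _ _
  | ha u v hu hv => simp only [map_add, hu, hv]; abel

theorem lmul_lmul (m m' : M) (x : TSq ι) : lmul ι m (lmul ι m' x) = lmul ι (m * m') x := by
  induction x using tsq_induction with
  | h₀ => simp
  | ht x y => simp [mul_assoc]
  | ha u v hu hv => simp only [map_add, hu, hv]

theorem rmul_rmul (m m' : M) (x : TSq ι) : rmul ι m (rmul ι m' x) = rmul ι (m' * m) x := by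
  induction x using tsq_induction with
  | h₀ => simp
  | ht x y => simp [mul_assoc]
  | ha u v hu hv => simp only [map_add, hu, hv]

theorem lmul_rmul (m m' : M) (x : TSq ι) : lmul ι m (rmul ι m' x) = rmul ι m' (lmul ι m x) := by
  induction x using tsq_induction with
  | h₀ => simp
  | ht x y => simp
  | ha u v hu hv => simp only [map_add, hu, hv]

theorem lmul_one (x : TSq ι) : lmul ι 1 x = x := by
  induction x using tsq_induction with
  | h₀ => simp
  | ht x y => simp
  | ha u v hu hv => simp only [map_add, hu, hv]

theorem rmul_one (x : TSq ι) : rmul ι 1 x = x := by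
  induction x using tsq_induction with
  | h₀ => simp
  | ht x y => simp
  | ha u v hu hv => simp only [map_add, hu, hv]

/-- The left action of `b ∈ B` on `M ⊗_N M`: `b·(x ⊗ y) = x b¹ ⊗ b² y`. -/
def sandwich (b : tsqCent ι) : TSq ι →+ TSq ι :=
  BalTensor.lift (fun x y => lmul ι x (rmul ι y b))
    (fun _ _ _ => lmul_add _ _ _ _) (fun _ _ _ => by rw [rmul_add, map_add])
    (fun n x y => by
      simp only [AddMonoidHom.mulRight_apply, AddMonoidHom.coe_mulLeft]
      rw [← lmul_lmul, lmul_rmul, b.2 n, rmul_rmul])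

@[simp] theorem sandwich_tm (b : tsqCent ι) (x y : M) :
    sandwich ι b (tm ι x y) = lmul ι x (rmul ι y b) := rfl

theorem sandwich_lmul (b : tsqCent ι) (m : M) (x : TSq ι) :
    sandwich ι b (lmul ι m x) = lmul ι m (sandwich ι b x) := by
  induction x using tsq_induction with
  | h₀ => simp
  | ht x y => simp [lmul_lmul]
  | ha u v hu hv => simp only [map_add, hu, hv]

theorem sandwich_rmul (b : tsqCent ι) (m : M) (x : TSq ι) :
    sandwich ι b (rmul ι m x) = rmul ι m (sandwich ι b x) := by
  induction x using tsq_induction with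
  | h₀ => simp
  | ht x y => simp [lmul_rmul, rmul_rmul]
  | ha u v hu hv => simp only [map_add, hu, hv]

instance : Mul (tsqCent ι) :=
  ⟨fun b b' => ⟨sandwich ι b b', fun n => by rw [← sandwich_lmul, ← sandwich_rmul, b'.2 n]⟩⟩

instance : One (tsqCent ι) :=
  ⟨⟨tm ι 1 1, fun n => by simpa using tm_bal (ι := ι) n 1 1⟩⟩

theorem tsqCent_coe_mul (b b' : tsqCent ι) :
    ((b * b' : tsqCent ι) : TSq ι) = sandwich ι b b' := rfl

theorem tsqCent_coe_one : ((1 : tsqCent ι) : TSq ι) = tm ι 1 1 := rfl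

/-- The ring `B`, with multiplication `b b' = b'¹ b¹ ⊗ b² b'²` and unit `1 ⊗ 1`. -/
instance : Ring (tsqCent ι) :=
  { (inferInstance : AddCommGroup (tsqCent ι)) with
    mul := (· * ·)
    one := 1
    mul_assoc := fun x y z => Subtype.ext <| by
      change sandwich ι (x * y) z = sandwich ι x (sandwich ι y z)
      refine DFunLike.congr_fun (g := (sandwich ι x).comp (sandwich ι y))
        (BalTensor.hom_ext fun a a' => ?_) z.1
      change sandwich ι (x * y) (tm ι a a') = sandwich ι x (sandwich ι y (tm ι a a'))
      simp [tsqCent_coe_mul, sandwich_lmul, sandwich_rmul]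
    one_mul := fun x => Subtype.ext <| by
      change sandwich ι 1 x = x
      refine DFunLike.congr_fun (g := AddMonoidHom.id _) (BalTensor.hom_ext fun a a' => ?_) x.1
      change sandwich ι 1 (tm ι a a') = tm ι a a'
      simp [tsqCent_coe_one]
    mul_one := fun x => Subtype.ext <| by
      change sandwich ι x (tm ι 1 1) = x
      simp [lmul_one, rmul_one]
    zero_mul := fun x => Subtype.ext <| by
      change sandwich ι 0 x = 0
      refine DFunLike.congr_fun (g := (0 : TSq ι →+ TSq ι))
        (BalTensor.hom_ext fun a a' => ?_) x.1
      change sandwich ι 0 (tm ι a a') = 0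
      simp
    mul_zero := fun x => Subtype.ext <| map_zero (sandwich ι x)
    left_distrib := fun x y z => Subtype.ext <| map_add (sandwich ι x) y.1 z.1
    right_distrib := fun x y z => Subtype.ext <| by
      change sandwich ι (x + y) z = sandwich ι x z + sandwich ι y z
      refine DFunLike.congr_fun (g := sandwich ι x + sandwich ι y)
        (BalTensor.hom_ext fun a a' => ?_) z.1
      change sandwich ι (x + y) (tm ι a a') = sandwich ι x (tm ι a a') + sandwich ι y (tm ι a a')
      simp }

/-- The source map `s_B(r) = 1 ⊗ r` and the target map `t_B(r) = r ⊗ 1` of `B`. -/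
def stB : SourceTarget (cent ι) (tsqCent ι) where
  s :=
    { toFun := fun r => ⟨tm ι 1 r, fun n => by
        have := tm_bal (ι := ι) n 1 (r : M)
        simpa [cent_comm] using this⟩
      map_one' := rfl
      map_mul' := fun r r' => Subtype.ext <| by
        simp [tsqCent_coe_mul]
      map_zero' := Subtype.ext <| map_zero (AddMonoidHom.mk' (tm ι 1) (BalTensor.tmul_add 1))
      map_add' := fun r r' => Subtype.ext <| BalTensor.tmul_add (1 : M) (r : M) (r' : M) }
  t :=
    { toFun := fun r => ⟨tm ι (unop r : cent ι) 1, fun n => by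
        have := tm_bal (ι := ι) n (unop r : cent ι) 1
        simpa [cent_comm] using this⟩
      map_one' := rfl
      map_mul' := fun r r' => Subtype.ext <| by
        simp [tsqCent_coe_mul]
      map_zero' := Subtype.ext <| map_zero (AddMonoidHom.mk' (fun x => tm ι x 1)
        (fun x y => BalTensor.add_tmul x y 1))
      map_add' := fun r r' => Subtype.ext <|
        BalTensor.add_tmul ((unop r : cent ι) : M) ((unop r' : cent ι) : M) (1 : M) }
  comm r r' := Subtype.ext <| by simp [tsqCent_coe_mul]

theorem stB_s (r : cent ι) : ((stB ι).s r : TSq ι) = tm ι 1 r := rfl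

theorem stB_t (r : cent ι) : ((stB ι).t (op r) : TSq ι) = tm ι r 1 := rfl

/-- The left `R`-action on `B` is `r·b = r b¹ ⊗ b²`. -/
theorem stB_la (r : cent ι) (b : tsqCent ι) : ((stB ι).la r b : TSq ι) = lmul ι r b := by
  simp [tsqCent_coe_mul, stB_t, rmul_one]

/-- The right `R`-action on `B` is `b·r = b¹ ⊗ b² r`. -/
theorem stB_ra (r : cent ι) (b : tsqCent ι) : ((stB ι).ra r b : TSq ι) = rmul ι r b := by
  simp [tsqCent_coe_mul, stB_s, lmul_one]

/-- `M ⊗_N (M ⊗_N M)`. -/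
abbrev TCube : Type _ :=
  BalTensor (fun n : N => AddMonoidHom.mulRight (ι n)) (fun n : N => lmul ι (ι n))

/-- The tensor `x ⊗ u` in `M ⊗_N (M ⊗_N M)`. -/
def tm₃ (x : M) (u : TSq ι) : TCube ι := BalTensor.tmul _ _ x u

/-- The left `M`-action on `M ⊗_N M ⊗_N M`. -/
def lmul₃ (m : M) : TCube ι →+ TCube ι :=
  BalTensor.map (AddMonoidHom.mulLeft m) (AddMonoidHom.id _)
    (fun _ _ => by simp [mul_assoc]) (fun _ _ => rfl)

/-- The right `M`-action on `M ⊗_N M ⊗_N M`. -/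
def rmul₃ (m : M) : TCube ι →+ TCube ι :=
  BalTensor.map (AddMonoidHom.id M) (rmul ι m) (fun _ _ => rfl)
    (fun _ _ => (lmul_rmul _ _ _ _).symm)

/-- `(M ⊗_N M ⊗_N M)^N`. -/
def tcubeCent : AddSubgroup (TCube ι) where
  carrier := {u | ∀ n : N, lmul₃ ι (ι n) u = rmul₃ ι (ι n) u}
  add_mem' hx hy n := by simp only [map_add, hx n, hy n]
  zero_mem' n := by simp
  neg_mem' hx n := by simp only [map_neg, hx n]

/-- For `u ∈ M ⊗_N M`, the map `M ⊗_N M → M ⊗_N M ⊗_N M`, `x ⊗ y ↦ x ⊗ y u`. -/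
def glue (u : TSq ι) : TSq ι →+ TCube ι :=
  BalTensor.map (AddMonoidHom.id M)
    (AddMonoidHom.mk' (fun y => lmul ι y u) (fun y y' => lmul_add ι y y' u))
    (fun _ _ => rfl) (fun _ _ => by simp [lmul_lmul])

@[simp] theorem glue_tm (u : TSq ι) (x y : M) : glue ι u (tm ι x y) = tm₃ ι x (lmul ι y u) := rfl

/-- The map `B ⊗_R B → M ⊗_N M ⊗_N M`, `b ⊗ b' ↦ b¹ ⊗ b² b'¹ ⊗ b'²`. -/
def tripleMap : (stB ι).Tensor →+ TCube ι :=
  BalTensor.lift (fun b b' => glue ι (b' : TSq ι) (b : TSq ι))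
    (fun _ _ _ => map_add _ _ _)
    (fun b b' b'' => by
      refine DFunLike.congr_fun (f := glue ι ((b' + b'' : tsqCent ι) : TSq ι))
        (g := glue ι (b' : TSq ι) + glue ι (b'' : TSq ι)) (BalTensor.hom_ext fun x y => ?_) b.1
      change tm₃ ι x (lmul ι y (b' + b'')) = tm₃ ι x (lmul ι y b') + tm₃ ι x (lmul ι y b'')
      rw [map_add]
      exact BalTensor.tmul_add _ _ _)
    (fun r b b' => by
      rw [stB_la, stB_ra]
      refine DFunLike.congr_fun (f := (glue ι (b' : TSq ι)).comp (rmul ι r))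
        (g := glue ι (lmul ι r b')) (BalTensor.hom_ext fun x y => ?_) b.1
      change tm₃ ι x (lmul ι (y * r) b') = tm₃ ι x (lmul ι y (lmul ι r b'))
      rw [lmul_lmul])

/-- The Sweedler coproduct `M ⊗_N M → M ⊗_N M ⊗_N M`, `x ⊗ y ↦ x ⊗ 1 ⊗ y`. -/
def sweedlerComul : TSq ι →+ TCube ι :=
  BalTensor.map (AddMonoidHom.id M) (AddMonoidHom.mk' (tm ι 1) (BalTensor.tmul_add 1))
    (fun _ _ => rfl)
    (fun n y => by
      change tm ι 1 (ι n * y) = tm ι (ι n * 1) y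
      rw [← tm_bal, one_mul, mul_one])

/-- The Sweedler counit (the multiplication map) `M ⊗_N M → M`, `x ⊗ y ↦ x y`. -/
def sweedlerCounit : TSq ι →+ M :=
  BalTensor.lift (fun x y => x * y) add_mul mul_add (fun _ _ _ => by simp [mul_assoc])

/-- The ring `End _N M` of left `N`-module endomorphisms of `M`, with composition. -/
def endLeft : Subring (AddMonoid.End M) where
  carrier := {ξ | ∀ (n : N) (x : M), ξ (ι n * x) = ι n * ξ x}
  mul_mem' {f g} hf hg n x := by
    change f (g (ι n * x)) = ι n * f (g x)
    rw [hg n x, hf n (g x)]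
  one_mem' n x := rfl
  add_mem' {f g} hf hg n x := by
    change f (ι n * x) + g (ι n * x) = ι n * (f x + g x)
    rw [hf n x, hg n x, mul_add]
  zero_mem' n x := (mul_zero (ι n)).symm
  neg_mem' {f} hf n x := by
    change -f (ι n * x) = ι n * -f x
    rw [hf n x, mul_neg]

theorem endLeft_map (ξ : endLeft ι) (n : N) (x : M) : ξ.1 (ι n * x) = ι n * ξ.1 x := ξ.2 n x

/-- `A = End _N M _N`, the ring of `N`-`N`-bimodule endomorphisms of `M`. -/
def endBi : Subring (AddMonoid.End M) where
  carrier := {α | (∀ (n : N) (x : M), α (ι n * x) = ι n * α x) ∧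
    ∀ (n : N) (x : M), α (x * ι n) = α x * ι n}
  mul_mem' {f g} hf hg := ⟨fun n x => by
      change f (g (ι n * x)) = ι n * f (g x)
      rw [hg.1 n x, hf.1 n (g x)], fun n x => by
      change f (g (x * ι n)) = f (g x) * ι n
      rw [hg.2 n x, hf.2 n (g x)]⟩
  one_mem' := ⟨fun _ _ => rfl, fun _ _ => rfl⟩
  add_mem' {f g} hf hg := ⟨fun n x => by
      change f (ι n * x) + g (ι n * x) = ι n * (f x + g x)
      rw [hf.1 n x, hg.1 n x, mul_add], fun n x => by
      change f (x * ι n) + g (x * ι n) = (f x + g x) * ι n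
      rw [hf.2 n x, hg.2 n x, add_mul]⟩
  zero_mem' := ⟨fun n _ => (mul_zero (ι n)).symm, fun n _ => (zero_mul (ι n)).symm⟩
  neg_mem' {f} hf := ⟨fun n x => by
      change -f (ι n * x) = ι n * -f x
      rw [hf.1 n x, mul_neg], fun n x => by
      change -f (x * ι n) = -f x * ι n
      rw [hf.2 n x, neg_mul]⟩

/-- `ξ ↦ b¹ ξ(b² x)` evaluated on a tensor `b ∈ M ⊗_N M`. -/
def evalAct (ξ : endLeft ι) (x : M) : TSq ι →+ M :=
  BalTensor.lift (fun a a' => a * ξ.1 (a' * x)) (fun _ _ _ => add_mul _ _ _)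
    (fun _ _ _ => by rw [add_mul, map_add, mul_add])
    (fun n a a' => by
      simp only [AddMonoidHom.mulRight_apply, AddMonoidHom.coe_mulLeft]
      rw [mul_assoc, ← endLeft_map, mul_assoc])

@[simp] theorem evalAct_tm (ξ : endLeft ι) (x a a' : M) :
    evalAct ι ξ x (tm ι a a') = a * ξ.1 (a' * x) := rfl

/-- The element `ξ ◁ b = b¹ ξ(b² -)` of `End _N M`, for `ξ ∈ End _N M` and `b ∈ B`. -/
def endAct (ξ : endLeft ι) (b : tsqCent ι) : endLeft ι :=
  ⟨AddMonoidHom.mk' (fun x => evalAct ι ξ x b) (fun x y => by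
      refine DFunLike.congr_fun (f := evalAct ι ξ (x + y))
        (g := evalAct ι ξ x + evalAct ι ξ y) (BalTensor.hom_ext fun a a' => ?_) b.1
      change a * ξ.1 (a' * (x + y)) = a * ξ.1 (a' * x) + a * ξ.1 (a' * y)
      rw [mul_add, map_add, mul_add]),
    fun n x => by
      change evalAct ι ξ (ι n * x) b = ι n * evalAct ι ξ x b
      have h₁ : ∀ u : TSq ι, evalAct ι ξ (ι n * x) u = evalAct ι ξ x (rmul ι (ι n) u) := by
        intro u
        induction u using tsq_induction with
        | h₀ => simp
        | ht a a' => simp [mul_assoc]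
        | ha u v hu hv => simp only [map_add, hu, hv]
      have h₂ : ∀ u : TSq ι, evalAct ι ξ x (lmul ι (ι n) u) = ι n * evalAct ι ξ x u := by
        intro u
        induction u using tsq_induction with
        | h₀ => simp
        | ht a a' => simp [mul_assoc]
        | ha u v hu hv => simp only [map_add, hu, hv, mul_add]
      rw [h₁, ← b.2 n, h₂]⟩

/-- The ring homomorphism `ρ : Mᵒᵖ → End _N M`, `ρ(m)(x) = x m`. -/
def rho : Mᵐᵒᵖ →+* endLeft ι where
  toFun m := ⟨AddMonoidHom.mulRight (unop m), fun n x => mul_assoc (ι n) x (unop m)⟩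
  map_one' := Subtype.ext <| AddMonoidHom.ext fun x => mul_one x
  map_mul' m m' := Subtype.ext <| AddMonoidHom.ext fun x => (mul_assoc x (unop m') (unop m)).symm
  map_zero' := Subtype.ext <| AddMonoidHom.ext fun x => mul_zero x
  map_add' m m' := Subtype.ext <| AddMonoidHom.ext fun x => mul_add x (unop m) (unop m')

/-- The map `x ⊗ y ↦ α(x) ⊗ y` on `M ⊗_N M`, for `α ∈ A`. -/
def mapLeft (α : endBi ι) : TSq ι →+ TSq ι :=
  BalTensor.map (α.1 : M →+ M) (AddMonoidHom.id M) (fun n x => α.2.2 n x) (fun _ _ => rfl)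

theorem mapLeft_tm (α : endBi ι) (x y : M) : mapLeft ι α (tm ι x y) = tm ι (α.1 x) y := rfl

/-- `α(b¹) ⊗ b² ∈ B` for `α ∈ A` and `b ∈ B`. -/
def applyLeft (α : endBi ι) (b : tsqCent ι) : tsqCent ι :=
  ⟨mapLeft ι α b, fun n => by
    have h₁ : ∀ u : TSq ι, lmul ι (ι n) (mapLeft ι α u) = mapLeft ι α (lmul ι (ι n) u) := by
      intro u
      induction u using tsq_induction with
      | h₀ => simp only [map_zero]
      | ht a a' =>
        rw [mapLeft_tm, lmul_tm, lmul_tm, mapLeft_tm, α.2.1 n a]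
      | ha u v hu hv => simp only [map_add, hu, hv]
    have h₂ : ∀ u : TSq ι, rmul ι (ι n) (mapLeft ι α u) = mapLeft ι α (rmul ι (ι n) u) := by
      intro u
      induction u using tsq_induction with
      | h₀ => simp only [map_zero]
      | ht a a' => rfl
      | ha u v hu hv => simp only [map_add, hu, hv]
    rw [h₁, h₂, b.2 n]⟩

/-- A left D2 quasibasis: `∑ᵢ bᵢ¹ ⊗ bᵢ² βᵢ(m) = m ⊗ 1` for all `m`. -/
def IsLeftD2Quasibasis {k : ℕ} (b : Fin k → tsqCent ι) (β : Fin k → endBi ι) : Prop :=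
  ∀ m : M, ∑ i, rmul ι ((β i).1 m) (b i : TSq ι) = tm ι m 1

end Extension

end DepthTwo

open DepthTwo

namespace DepthTwo

/-! ### Calculus of `M ⊗_N M` and `M ⊗_N M ⊗_N M`. -/

section Cube

variable {N M : Type*} [Ring N] [Ring M] (ι : N →+* M)

/-! A left D2 quasibasis `∑ bᵢ¹ ⊗ bᵢ² βᵢ(m) = m ⊗ 1` exists because a split embedding of `M ⊗_N M`
into `M^k` has coordinates: `bᵢ` is the image of the `i`-th basis vector under the retraction, and
`βᵢ(m)` is the `i`-th coordinate of `m ⊗ 1` (`IsLeftD2.exists_quasibasis`). Replacing the first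
factor of `x ⊗ y ⊗ z` by this sum gives `x ⊗ y ⊗ z = ∑ bᵢ¹ ⊗ bᵢ² βᵢ(x) y ⊗ z`. On `N`-central
elements the right-hand tensors lie in `B`, so `v ↦ ∑ bᵢ ⊗_R (βᵢ(v¹) v² ⊗ v³)` is inverse to
`tripleMap`. It is a left inverse because `βᵢ(c¹) c²` lies in `R` and can be moved across `⊗_R`,
which turns the sum back into `c ⊗ c'`.

Injectivity of `tripleMap` is then the main tool: an identity in `B ⊗_R B` may be checked in `M ⊗_N
M ⊗_N M`, where `Δ_B` becomes the Sweedler coproduct `b¹ ⊗ 1 ⊗ b²`. The Takeuchi condition holds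
because `s(r) ⊗ 1` and `1 ⊗ t(r)` both put `r` in the middle slot. Multiplicativity holds because `X
Δ(b)` corresponds to `b¹ X b²` (`tripleMap_mulT`), and the counit laws reduce to `b¹ 1 ⊗ b² = b = b¹
⊗ 1 b²`. Coassociativity needs no fourfold tensor product over `N`: it follows from `Δ` commuting
with `α(b¹) ⊗ b²` for `α ∈ A`.

For `End _N M`, the product `(ξ ◁ c)(η ◁ c')` depends only on the image of `c ⊗ c'` in the threefold
tensor product, and evaluating it on `b¹ ⊗ 1 ⊗ b²` gives `(ξη) ◁ b`. Right D2 enters only for the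
invariants: writing `1 ⊗ m = ∑ γⱼ(m) cⱼ` with `cⱼ ∈ B`, an invariant `ξ` satisfies `ξ(m) = ∑ γⱼ(m)
ε(cⱼ) ξ(1) = m ξ(1)` (`IsRightD2.mem_range_rho`). -/

@[simp] theorem sweedlerCounit_tm (x y : M) : sweedlerCounit ι (tm ι x y) = x * y := rfl

@[simp] theorem sweedlerComul_tm (x y : M) :
    sweedlerComul ι (tm ι x y) = tm₃ ι x (tm ι 1 y) := rfl

@[simp] theorem lmul₃_tm₃ (m x : M) (u : TSq ι) : lmul₃ ι m (tm₃ ι x u) = tm₃ ι (m * x) u := rfl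

@[simp] theorem rmul₃_tm₃ (m x : M) (u : TSq ι) :
    rmul₃ ι m (tm₃ ι x u) = tm₃ ι x (rmul ι m u) := rfl

variable {ι} in
theorem tcube_induction {p : TCube ι → Prop} (h₀ : p 0) (ht : ∀ x u, p (tm₃ ι x u))
    (ha : ∀ u v, p u → p v → p (u + v)) (u : TCube ι) : p u :=
  BalTensor.induction h₀ ht ha u

variable {ι} in
theorem tsq_hom_ext {Z : Type*} [AddCommGroup Z] {f g : TSq ι →+ Z}
    (h : ∀ x y, f (tm ι x y) = g (tm ι x y)) : f = g :=
  BalTensor.hom_ext h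

theorem tm₃_add (x : M) (u v : TSq ι) : tm₃ ι x (u + v) = tm₃ ι x u + tm₃ ι x v :=
  BalTensor.tmul_add _ _ _

theorem add_tm₃ (x y : M) (u : TSq ι) : tm₃ ι (x + y) u = tm₃ ι x u + tm₃ ι y u :=
  BalTensor.add_tmul _ _ _

@[simp] theorem tm₃_zero (x : M) : tm₃ ι x 0 = 0 :=
  map_zero (AddMonoidHom.mk' (tm₃ ι x) (tm₃_add ι x))

theorem lmul₃_add (m m' : M) (u : TCube ι) :
    lmul₃ ι (m + m') u = lmul₃ ι m u + lmul₃ ι m' u := by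
  induction u using tcube_induction with
  | h₀ => simp
  | ht x u => simp [add_mul, add_tm₃]
  | ha u v hu hv => simp only [map_add, hu, hv]; abel

theorem rmul₃_add (m m' : M) (u : TCube ι) :
    rmul₃ ι (m + m') u = rmul₃ ι m u + rmul₃ ι m' u := by
  induction u using tcube_induction with
  | h₀ => simp
  | ht x u => simp [rmul_add, tm₃_add]
  | ha u v hu hv => simp only [map_add, hu, hv]; abel

theorem lmul₃_lmul₃ (m m' : M) (u : TCube ι) :
    lmul₃ ι m (lmul₃ ι m' u) = lmul₃ ι (m * m') u := by
  induction u using tcube_induction with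
  | h₀ => simp
  | ht x u => simp [mul_assoc]
  | ha u v hu hv => simp only [map_add, hu, hv]

theorem rmul₃_rmul₃ (m m' : M) (u : TCube ι) :
    rmul₃ ι m (rmul₃ ι m' u) = rmul₃ ι (m' * m) u := by
  induction u using tcube_induction with
  | h₀ => simp
  | ht x u => simp [rmul_rmul]
  | ha u v hu hv => simp only [map_add, hu, hv]

theorem lmul₃_rmul₃ (m m' : M) (u : TCube ι) :
    lmul₃ ι m (rmul₃ ι m' u) = rmul₃ ι m' (lmul₃ ι m u) := by
  induction u using tcube_induction with
  | h₀ => simp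
  | ht x u => simp
  | ha u v hu hv => simp only [map_add, hu, hv]

theorem glue_lmul (u c : TSq ι) (m : M) : glue ι u (lmul ι m c) = lmul₃ ι m (glue ι u c) := by
  induction c using tsq_induction with
  | h₀ => simp
  | ht x y => simp
  | ha u v hu hv => simp only [map_add, hu, hv]

theorem glue_rmul (u c : TSq ι) (m : M) : glue ι u (rmul ι m c) = glue ι (lmul ι m u) c := by
  induction c using tsq_induction with
  | h₀ => simp
  | ht x y => simp [lmul_lmul]
  | ha u v hu hv => simp only [map_add, hu, hv]

theorem glue_rmul_left (u c : TSq ι) (m : M) :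
    glue ι (rmul ι m u) c = rmul₃ ι m (glue ι u c) := by
  induction c using tsq_induction with
  | h₀ => simp
  | ht x y => simp [lmul_rmul]
  | ha u v hu hv => simp only [map_add, hu, hv]

theorem glue_add (u v c : TSq ι) : glue ι (u + v) c = glue ι u c + glue ι v c := by
  induction c using tsq_induction with
  | h₀ => simp
  | ht x y => simp [tm₃_add]
  | ha a b ha hb => simp only [map_add, ha, hb]; abel

theorem sweedlerComul_lmul (m : M) (u : TSq ι) :
    sweedlerComul ι (lmul ι m u) = lmul₃ ι m (sweedlerComul ι u) := by
  induction u using tsq_induction with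
  | h₀ => simp
  | ht x y => simp
  | ha u v hu hv => simp only [map_add, hu, hv]

theorem sweedlerComul_rmul (m : M) (u : TSq ι) :
    sweedlerComul ι (rmul ι m u) = rmul₃ ι m (sweedlerComul ι u) := by
  induction u using tsq_induction with
  | h₀ => simp
  | ht x y => simp
  | ha u v hu hv => simp only [map_add, hu, hv]

theorem sweedlerCounit_lmul (m : M) (u : TSq ι) :
    sweedlerCounit ι (lmul ι m u) = m * sweedlerCounit ι u := by
  induction u using tsq_induction with
  | h₀ => simp
  | ht x y => simp [mul_assoc]
  | ha u v hu hv => simp only [map_add, hu, hv, mul_add]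

theorem sweedlerCounit_rmul (m : M) (u : TSq ι) :
    sweedlerCounit ι (rmul ι m u) = sweedlerCounit ι u * m := by
  induction u using tsq_induction with
  | h₀ => simp
  | ht x y => simp [mul_assoc]
  | ha u v hu hv => simp only [map_add, hu, hv, add_mul]

theorem sweedlerComul_mem (b : tsqCent ι) : sweedlerComul ι (b : TSq ι) ∈ tcubeCent ι :=
  fun n => by rw [← sweedlerComul_lmul, ← sweedlerComul_rmul, b.2 n]

/-! ### The map `B ⊗_R B → (M ⊗_N M ⊗_N M)^N` -/

theorem tripleMap_tmul (b b' : tsqCent ι) :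
    tripleMap ι (BalTensor.tmul (stB ι).ra (stB ι).la b b') = glue ι (b' : TSq ι) (b : TSq ι) :=
  rfl

/-- An `n` multiplied on the left passes through `b` by centrality, crosses the glued middle slot,
and leaves on the right through `b'`. -/
theorem tripleMap_mem (X : (stB ι).Tensor) : tripleMap ι X ∈ tcubeCent ι := by
  induction X using BalTensor.induction with
  | h₀ => simp
  | ht b b' =>
    intro n
    rw [tripleMap_tmul, ← glue_lmul, ← glue_rmul_left, b.2 n, glue_rmul, b'.2 n]
  | ha u v hu hv => rw [map_add]; exact add_mem hu hv

theorem tripleMap_tensorLa (r : cent ι) (X : (stB ι).Tensor) :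
    tripleMap ι ((stB ι).tensorLa r X) = lmul₃ ι r (tripleMap ι X) := by
  induction X using BalTensor.induction with
  | h₀ => simp
  | ht b b' =>
    change glue ι (b' : TSq ι) ((stB ι).la r b : TSq ι) = lmul₃ ι r (glue ι (b' : TSq ι) b)
    rw [stB_la, glue_lmul]
  | ha u v hu hv => simp only [map_add, hu, hv]

theorem tripleMap_tensorRa (r : cent ι) (X : (stB ι).Tensor) :
    tripleMap ι ((stB ι).tensorRa r X) = rmul₃ ι r (tripleMap ι X) := by
  induction X using BalTensor.induction with
  | h₀ => simp
  | ht b b' =>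
    change glue ι ((stB ι).ra r b' : TSq ι) (b : TSq ι) = rmul₃ ι r (glue ι (b' : TSq ι) b)
    rw [stB_ra, glue_rmul_left]
  | ha u v hu hv => simp only [map_add, hu, hv]

/-- The map `M ⊗_N M ⊗_N M → M ⊗_N M`, `x ⊗ y ⊗ z ↦ α(x) y ⊗ z`, for `α ∈ A`. -/
def contractLeft (α : endBi ι) : TCube ι →+ TSq ι :=
  BalTensor.lift (fun x u => lmul ι (α.1 x) u)
    (fun _ _ _ => by rw [map_add, lmul_add]) (fun _ _ _ => map_add _ _ _)
    (fun n x u => by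
      rw [AddMonoidHom.mulRight_apply, α.2.2 n x, lmul_lmul])

@[simp] theorem contractLeft_tm₃ (α : endBi ι) (x : M) (u : TSq ι) :
    contractLeft ι α (tm₃ ι x u) = lmul ι (α.1 x) u := rfl

theorem contractLeft_lmul₃ (α : endBi ι) (n : N) (v : TCube ι) :
    contractLeft ι α (lmul₃ ι (ι n) v) = lmul ι (ι n) (contractLeft ι α v) := by
  induction v using tcube_induction with
  | h₀ => simp
  | ht x u => simp [α.2.1 n x, lmul_lmul]
  | ha u v hu hv => simp only [map_add, hu, hv]

theorem contractLeft_rmul₃ (α : endBi ι) (m : M) (v : TCube ι) :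
    contractLeft ι α (rmul₃ ι m v) = rmul ι m (contractLeft ι α v) := by
  induction v using tcube_induction with
  | h₀ => simp
  | ht x u => simp [lmul_rmul]
  | ha u v hu hv => simp only [map_add, hu, hv]

/-- The restriction of `contractLeft` to `(M ⊗_N M ⊗_N M)^N → B`. -/
def contractCent (α : endBi ι) : tcubeCent ι →+ tsqCent ι :=
  ((contractLeft ι α).comp (tcubeCent ι).subtype).codRestrict (tsqCent ι) fun v n => by
    change lmul ι (ι n) (contractLeft ι α v) = rmul ι (ι n) (contractLeft ι α v)
    rw [← contractLeft_lmul₃, ← contractLeft_rmul₃, v.2 n]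

@[simp] theorem coe_contractCent (α : endBi ι) (v : tcubeCent ι) :
    (contractCent ι α v : TSq ι) = contractLeft ι α v := rfl

/-- The counit `ε_B(b) = b¹ b²` of `B`. -/
def counitB : tsqCent ι →+ cent ι where
  toFun b := ⟨sweedlerCounit ι b, Subring.mem_centralizer_iff.2 <| by
    rintro _ ⟨n, rfl⟩
    rw [← sweedlerCounit_lmul, ← sweedlerCounit_rmul, b.2 n]⟩
  map_zero' := Subtype.ext <| map_zero (sweedlerCounit ι)
  map_add' b b' := Subtype.ext <| map_add (sweedlerCounit ι) b.1 b'.1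

@[simp] theorem coe_counitB (b : tsqCent ι) : (counitB ι b : M) = sweedlerCounit ι b := rfl

/-- When `c ∈ B`, the scalar `α(c¹) c²` on the right is an element of `R`; this is what later allows
it to cross `⊗_R`. -/
theorem contractLeft_glue (α : endBi ι) (u c : TSq ι) :
    contractLeft ι α (glue ι u c) = lmul ι (sweedlerCounit ι (mapLeft ι α c)) u := by
  induction c using tsq_induction with
  | h₀ => simpa using (map_zero (AddMonoidHom.mk' (fun m => lmul ι m u)
      (fun m m' => lmul_add ι m m' u))).symm
  | ht x y => simp [mapLeft_tm, lmul_lmul]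
  | ha a b ha hb => simp only [map_add, ha, hb, lmul_add]

/-! ### Inverting the map by a left quasibasis. -/

variable {ι} {k : ℕ} {b : Fin k → tsqCent ι} {β : Fin k → endBi ι}

theorem IsLeftD2Quasibasis.sum_tm₃ (h : IsLeftD2Quasibasis ι b β) (x : M) (u : TSq ι) :
    ∑ i, glue ι (lmul ι ((β i).1 x) u) (b i : TSq ι) = tm₃ ι x u := by
  have := congrArg (glue ι u) (h x)
  simpa [glue_rmul, lmul_one] using this

/-- Expanding the first tensor factor by the quasibasis reconstructs `v`. Restricted to `N`-central
`v`, this exhibits a right inverse of `tripleMap`. -/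
theorem IsLeftD2Quasibasis.sum_glue (h : IsLeftD2Quasibasis ι b β) (v : TCube ι) :
    ∑ i, glue ι (contractLeft ι (β i) v) (b i : TSq ι) = v := by
  induction v using tcube_induction with
  | h₀ =>
    refine Finset.sum_eq_zero fun i _ => ?_
    rw [map_zero]
    refine DFunLike.congr_fun (g := (0 : TSq ι →+ TCube ι)) (tsq_hom_ext fun x y => ?_) _
    simp
  | ht x u => simpa using h.sum_tm₃ x u
  | ha u v hu hv => simp only [map_add, glue_add, Finset.sum_add_distrib, hu, hv]

/-- The quasibasis identity for `x`, multiplied on the right by `y`: the `bᵢ` generate `M ⊗_N M` as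
a right `M`-module, with explicit coefficients. -/
theorem IsLeftD2Quasibasis.sum_rmul (h : IsLeftD2Quasibasis ι b β) (u : TSq ι) :
    ∑ i, rmul ι (sweedlerCounit ι (mapLeft ι (β i) u)) (b i : TSq ι) = u := by
  induction u using tsq_induction with
  | h₀ =>
    refine Finset.sum_eq_zero fun i _ => ?_
    rw [map_zero, map_zero]
    exact map_zero (AddMonoidHom.mk' (fun m => rmul ι m (b i : TSq ι))
      (fun m m' => rmul_add ι m m' _))
  | ht x y =>
    have := congrArg (rmul ι y) (h x)
    simpa [rmul_rmul, mapLeft_tm] using this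
  | ha u v hu hv => simp only [map_add, rmul_add, Finset.sum_add_distrib, hu, hv]

/-- The left inverse of `tripleMap`. On `c ⊗ c'` the coefficients `βᵢ(c¹) c²` lie in `R`, so they
move from `c'` to `bᵢ`, and `∑ bᵢ · βᵢ(c¹) c² = c` by `sum_rmul`. -/
theorem IsLeftD2Quasibasis.sum_tmul_contractCent (h : IsLeftD2Quasibasis ι b β)
    (X : (stB ι).Tensor) :
    ∑ i, BalTensor.tmul (stB ι).ra (stB ι).la (b i)
      (contractCent ι (β i) ⟨tripleMap ι X, tripleMap_mem ι X⟩) = X := by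
  -- Packaged as one additive map so that only pure tensors need checking.
  let f : (stB ι).Tensor →+ (stB ι).Tensor := ∑ i,
    (AddMonoidHom.mk' (BalTensor.tmul (stB ι).ra (stB ι).la (b i)) (BalTensor.tmul_add (b i))).comp
      ((contractCent ι (β i)).comp ((tripleMap ι).codRestrict (tcubeCent ι) (tripleMap_mem ι)))
  have hf : f = AddMonoidHom.id _ := by
    refine BalTensor.hom_ext fun c c' => ?_
    have h₁ : ∀ i, contractCent ι (β i) ⟨glue ι (c' : TSq ι) c,
        tripleMap_mem ι (BalTensor.tmul (stB ι).ra (stB ι).la c c')⟩ =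
        (stB ι).la (counitB ι (applyLeft ι (β i) c)) c' := fun i => Subtype.ext <| by
      rw [stB_la, coe_contractCent, contractLeft_glue]
      rfl
    have h₂ : f (BalTensor.tmul (stB ι).ra (stB ι).la c c') =
        ∑ i, BalTensor.tmul (stB ι).ra (stB ι).la (b i)
          ((stB ι).la (counitB ι (applyLeft ι (β i) c)) c') := by
      simp only [f, AddMonoidHom.finsetSum_apply]
      exact Finset.sum_congr rfl fun i _ =>
        congrArg (BalTensor.tmul (stB ι).ra (stB ι).la (b i)) (h₁ i)
    have h₃ : ∑ i, (stB ι).ra (counitB ι (applyLeft ι (β i) c)) (b i) = c := Subtype.ext <| by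
      rw [AddSubgroup.val_finsetSum]
      simp only [stB_ra]
      exact h.sum_rmul c
    rw [h₂]
    simp only [← BalTensor.tmul_bal]
    have h₄ := map_sum (AddMonoidHom.mk'
      (fun a => BalTensor.tmul (stB ι).ra (stB ι).la a c')
      (fun a a' => BalTensor.add_tmul a a' c'))
      (fun i => (stB ι).ra (counitB ι (applyLeft ι (β i) c)) (b i)) Finset.univ
    rw [h₃] at h₄
    exact h₄.symm
  have := DFunLike.congr_fun hf X
  simp only [f, AddMonoidHom.finsetSum_apply] at this
  exact this

theorem IsLeftD2Quasibasis.tripleMap_injective (h : IsLeftD2Quasibasis ι b β) :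
    Function.Injective (tripleMap ι) := fun X Y hXY => by
  rw [← h.sum_tmul_contractCent X, ← h.sum_tmul_contractCent Y]
  simp only [hXY]

theorem IsLeftD2Quasibasis.range_tripleMap (h : IsLeftD2Quasibasis ι b β) :
    (tripleMap ι).range = tcubeCent ι := by
  refine le_antisymm ?_ fun v hv => ?_
  · rintro _ ⟨X, rfl⟩
    exact tripleMap_mem ι X
  · refine ⟨∑ i, BalTensor.tmul (stB ι).ra (stB ι).la (b i) (contractCent ι (β i) ⟨v, hv⟩), ?_⟩
    rw [map_sum]
    exact h.sum_glue v

end Cube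

/-! ### Quasibases -/

section Quasibasis

/-- The retraction is the projection along the complement `W`; it is bilinear because `W` is stable
under both actions. -/
theorem IsBimoduleSummand.exists_retraction {S T P Q : Type*} [AddCommGroup P] [AddCommGroup Q]
    {lP : S → P → P} {rP : T → P → P} {lQ : S → Q → Q} {rQ : T → Q → Q}
    (h : IsBimoduleSummand lP rP lQ rQ) (hl : ∀ s q q', lQ s (q - q') = lQ s q - lQ s q')
    (hr : ∀ t q q', rQ t (q - q') = rQ t q - rQ t q') :
    ∃ (σ : P →+ Q) (π : Q →+ P), (∀ p, π (σ p) = p) ∧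
      (∀ s p, σ (lP s p) = lQ s (σ p)) ∧ (∀ t p, σ (rP t p) = rQ t (σ p)) ∧
      (∀ s q, π (lQ s q) = lP s (π q)) ∧ (∀ t q, π (rQ t q) = rP t (π q)) := by
  obtain ⟨σ, W, hinj, hσl, hσr, hWl, hWr, hcompl⟩ := h
  have hex : ∀ q, ∃ p, q - σ p ∈ W := fun q => by
    have hq : q ∈ σ.range ⊔ W := hcompl.sup_eq_top ▸ AddSubgroup.mem_top q
    obtain ⟨_, ⟨p, rfl⟩, w, hw, rfl⟩ := AddSubgroup.mem_sup.1 hq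
    exact ⟨p, by simpa using hw⟩
  -- Since `q - σ p ∈ W` determines `p`, each property of `π` below is proved by exhibiting the
  -- expected value as a second solution.
  have huniq : ∀ q p p', q - σ p ∈ W → q - σ p' ∈ W → p = p' := fun q p p' hp hp' => by
    have h₁ : σ (p - p') ∈ W := by
      have := W.sub_mem hp' hp
      rw [map_sub]
      convert this using 1
      abel
    have h₂ : σ (p - p') ∈ σ.range ⊓ W := ⟨⟨_, rfl⟩, h₁⟩
    rw [hcompl.inf_eq_bot, AddSubgroup.mem_bot] at h₂
    exact sub_eq_zero.1 (hinj (h₂.trans (map_zero σ).symm))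
  choose π hπ using hex
  refine ⟨σ, AddMonoidHom.mk' π fun q q' => ?_, fun p => ?_, hσl, hσr, fun s q => ?_,
    fun t q => ?_⟩
  · refine huniq (q + q') _ _ (hπ _) ?_
    rw [map_add, add_sub_add_comm]
    exact W.add_mem (hπ q) (hπ q')
  · refine huniq (σ p) _ _ (hπ _) ?_
    rw [sub_self]
    exact W.zero_mem
  · refine huniq (lQ s q) _ _ (hπ _) ?_
    rw [AddMonoidHom.mk'_apply, hσl, ← hl]
    exact hWl s _ (hπ q)
  · refine huniq (rQ t q) _ _ (hπ _) ?_
    rw [AddMonoidHom.mk'_apply, hσr, ← hr]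
    exact hWr t _ (hπ q)

variable {N M : Type*} [Ring N] [Ring M] {ι : N →+* M}

/-- With `σ`, `π` the embedding and retraction, `bᵢ = π(eᵢ)` and `βᵢ(x) = σ(x ⊗ 1)ᵢ`. The quasibasis
identity is `π σ (m ⊗ 1) = m ⊗ 1` expanded in coordinates by right `M`-linearity of `π`. -/
theorem IsLeftD2.exists_quasibasis (h : IsLeftD2 ι) :
    ∃ (k : ℕ) (b : Fin k → tsqCent ι) (β : Fin k → endBi ι), IsLeftD2Quasibasis ι b β := by
  obtain ⟨k, -, hk⟩ := h
  obtain ⟨σ, π, hπσ, hσl, hσr, hπl, hπr⟩ := hk.exists_retraction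
    (fun a f g => funext fun i => mul_sub (ι a) (f i) (g i))
    (fun m f g => funext fun i => sub_mul (f i) (g i) m)
  refine ⟨k, fun i => ⟨π (Pi.single i 1), fun n => ?_⟩,
    fun i => ⟨(Pi.evalAddMonoidHom (fun _ => M) i).comp (σ.comp
      (AddMonoidHom.mk' (fun x => tm ι x 1) fun x y => BalTensor.add_tmul x y 1)),
      fun n x => ?_, fun n x => ?_⟩, fun m => ?_⟩
  -- Centrality of `π(eᵢ)` reduces to `n eᵢ = eᵢ n` in `M^k`, whose entries are `0` and `1`.
  · rw [← hπl, ← hπr]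
    congr 1
    funext j
    by_cases hj : j = i
    · subst hj; simp
    · simp [hj]
  · exact congrFun (hσl n (tm ι x 1)) i
  -- Right `N`-linearity of `βᵢ` uses `x n ⊗ 1 = x ⊗ n = (x ⊗ 1) n`.
  · refine Eq.trans ?_ (congrFun (hσr (ι n) (tm ι x 1)) i)
    change σ (tm ι (x * ι n) 1) i = σ (tm ι x (1 * ι n)) i
    rw [tm_bal, one_mul, mul_one]
  · refine Eq.trans ?_ (hπσ (tm ι m 1))
    rw [show σ (tm ι m 1) = ∑ i, fun j => (Pi.single i 1 : Fin k → M) j * σ (tm ι m 1) i from ?_,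
      map_sum]
    · exact Finset.sum_congr rfl fun i _ => (hπr _ _).symm
    · funext j
      rw [Finset.sum_apply, Finset.sum_eq_single j]
      · simp
      · intro i _ hi
        simp [hi.symm]
      · simp

/-- A right D2 extension has a right D2 quasibasis: `∑ⱼ γⱼ(m) cⱼ¹ ⊗ cⱼ² = 1 ⊗ m` for all `m`. -/
theorem IsRightD2.exists_quasibasis (h : IsRightD2 ι) :
    ∃ (k : ℕ) (c : Fin k → tsqCent ι) (γ : Fin k → M → M),
      ∀ m : M, ∑ j, lmul ι (γ j m) (c j : TSq ι) = tm ι 1 m := by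
  obtain ⟨k, -, hk⟩ := h
  obtain ⟨σ, π, hπσ, hσl, hσr, hπl, hπr⟩ := hk.exists_retraction
    (fun m f g => funext fun i => mul_sub m (f i) (g i))
    (fun a f g => funext fun i => sub_mul (f i) (g i) (ι a))
  refine ⟨k, fun i => ⟨π (Pi.single i 1), fun n => ?_⟩, fun i m => σ (tm ι 1 m) i, fun m => ?_⟩
  · rw [← hπl, ← hπr]
    congr 1
    funext j
    by_cases hj : j = i
    · subst hj; simp
    · simp [hj]
  · refine Eq.trans ?_ (hπσ (tm ι 1 m))
    rw [show σ (tm ι 1 m) = ∑ i, fun j => σ (tm ι 1 m) i * (Pi.single i 1 : Fin k → M) j from ?_,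
      map_sum]
    · exact Finset.sum_congr rfl fun i _ => (hπl _ _).symm
    · funext j
      rw [Finset.sum_apply, Finset.sum_eq_single j]
      · simp
      · intro i _ hi
        simp [hi.symm]
      · simp

end Quasibasis

/-! ### The bialgebroid structure of `B` -/

section Comul

variable {N M : Type*} [Ring N] [Ring M] (ι : N →+* M)

/-- The map `x ⊗ y ⊗ z ↦ x ⊗ y c¹ ⊗ c² z` for `c ∈ B`. -/
def sandwichRight (c : tsqCent ι) : TCube ι →+ TCube ι :=
  BalTensor.map (AddMonoidHom.id M) (sandwich ι c) (fun _ _ => rfl)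
    (fun n u => sandwich_lmul ι c (ι n) u)

@[simp] theorem sandwichRight_tm₃ (c : tsqCent ι) (x : M) (u : TSq ι) :
    sandwichRight ι c (tm₃ ι x u) = tm₃ ι x (sandwich ι c u) := rfl

/-- The map `x ⊗ y ⊗ z ↦ x c¹ ⊗ c² y ⊗ z` for `c ∈ B`. -/
def sandwichLeft (c : tsqCent ι) : TCube ι →+ TCube ι :=
  BalTensor.lift (fun x u => lmul₃ ι x (glue ι u c))
    (fun _ _ _ => lmul₃_add ι _ _ _) (fun _ _ _ => by rw [glue_add, map_add])
    (fun n x u => by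
      rw [AddMonoidHom.mulRight_apply, ← lmul₃_lmul₃, ← glue_lmul, c.2 n, glue_rmul])

@[simp] theorem sandwichLeft_tm₃ (c : tsqCent ι) (x : M) (u : TSq ι) :
    sandwichLeft ι c (tm₃ ι x u) = lmul₃ ι x (glue ι u c) := rfl

theorem sandwichLeft_sandwichRight_glue (c c' : tsqCent ι) (u v : TSq ι) :
    sandwichLeft ι c (sandwichRight ι c' (glue ι u v)) =
      glue ι (sandwich ι c' u) (sandwich ι c v) := by
  induction v using tsq_induction with
  | h₀ => simp
  | ht x y => simp [sandwich_lmul, glue_lmul, glue_rmul]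
  | ha u v hu hv => simp only [map_add, hu, hv]

/-- Factorwise left multiplication by `c ⊗ c'` extends to all of `M ⊗_N M ⊗_N M` as two
commuting-in-place insertions, `c` at the first tensor sign and `c'` at the second. -/
theorem tripleMap_legMul (c c' : tsqCent ι) (X : (stB ι).Tensor) :
    tripleMap ι ((stB ι).legMul c c' X) =
      sandwichLeft ι c (sandwichRight ι c' (tripleMap ι X)) := by
  induction X using BalTensor.induction with
  | h₀ => simp
  | ht b b' =>
    rw [SourceTarget.legMul_tmul, tripleMap_tmul, tripleMap_tmul,
      sandwichLeft_sandwichRight_glue]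
    rfl
  | ha u v hu hv => simp only [map_add, hu, hv]

/-- The map `x ⊗ z ↦ x v z` for `v ∈ (M ⊗_N M ⊗_N M)^N`. -/
def cubeSandwich (v : tcubeCent ι) : TSq ι →+ TCube ι :=
  BalTensor.lift (fun x z => lmul₃ ι x (rmul₃ ι z v))
    (fun _ _ _ => lmul₃_add ι _ _ _) (fun _ _ _ => by rw [rmul₃_add, map_add])
    (fun n x z => by
      simp only [AddMonoidHom.mulRight_apply, AddMonoidHom.coe_mulLeft]
      rw [← lmul₃_lmul₃, lmul₃_rmul₃, v.2 n, rmul₃_rmul₃])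

@[simp] theorem cubeSandwich_tm (v : tcubeCent ι) (x z : M) :
    cubeSandwich ι v (tm ι x z) = lmul₃ ι x (rmul₃ ι z v) := rfl

theorem cubeSandwich_add (v w : tcubeCent ι) (u : TSq ι) :
    cubeSandwich ι (v + w) u = cubeSandwich ι v u + cubeSandwich ι w u :=
  DFunLike.congr_fun (g := cubeSandwich ι v + cubeSandwich ι w)
    (tsq_hom_ext fun x z => by simp) u

theorem cubeSandwich_zero (u : TSq ι) : cubeSandwich ι 0 u = 0 :=
  DFunLike.congr_fun (g := (0 : TSq ι →+ TCube ι)) (tsq_hom_ext fun x z => by simp) u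

theorem cubeSandwich_sweedlerComul (b : tsqCent ι) (u : TSq ι) :
    cubeSandwich ι ⟨sweedlerComul ι b, sweedlerComul_mem ι b⟩ u =
      sweedlerComul ι (sandwich ι b u) := by
  induction u using tsq_induction with
  | h₀ => simp
  | ht x z => simp [sweedlerComul_lmul, sweedlerComul_rmul]
  | ha u v hu hv => simp only [map_add, hu, hv]

/-- The middle `1` lets the two insertions merge: `x ⊗ 1 ⊗ z` becomes `x c¹ ⊗ c² c'¹ ⊗ c'² z`, which
is the image of `c ⊗ c'` multiplied by `x` and `z` from outside. -/
theorem sandwichLeft_sandwichRight_sweedlerComul (c c' : tsqCent ι) (u : TSq ι) :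
    sandwichLeft ι c (sandwichRight ι c' (sweedlerComul ι u)) =
      cubeSandwich ι ⟨glue ι (c' : TSq ι) c,
        tripleMap_mem ι (BalTensor.tmul (stB ι).ra (stB ι).la c c')⟩ u := by
  induction u using tsq_induction with
  | h₀ => simp
  | ht x z => simp [glue_rmul_left, lmul_one]
  | ha u v hu hv => simp only [map_add, hu, hv]

/-- If `Y ∈ B ×_R B` corresponds to `b¹ ⊗ 1 ⊗ b²`, then `X Y` corresponds to
`b¹ · X · b²`, where `X` is regarded as an element of `(M ⊗_N M ⊗_N M)^N`. -/
theorem tripleMap_mulT (Y : (stB ι).takeuchi) (b : TSq ι)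
    (hY : tripleMap ι (Y : (stB ι).Tensor) = sweedlerComul ι b) (X : (stB ι).Tensor) :
    tripleMap ι ((stB ι).mulT Y X) = cubeSandwich ι ⟨tripleMap ι X, tripleMap_mem ι X⟩ b := by
  induction X using BalTensor.induction with
  | h₀ =>
    rw [map_zero ((stB ι).mulT Y)]
    refine (map_zero (tripleMap ι)).trans ((cubeSandwich_zero ι b).symm.trans ?_)
    congr 2
  | ht c c' =>
    rw [SourceTarget.mulT_tmul, tripleMap_legMul, hY, sandwichLeft_sandwichRight_sweedlerComul]
    rfl
  | ha u v hu hv =>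
    rw [map_add, map_add, hu, hv, ← cubeSandwich_add]
    congr 2
    exact Subtype.ext (map_add (tripleMap ι) u v).symm

/-- Both sides send `x ⊗ 1 ⊗ y` to `x ⊗ r ⊗ y`. This is the Takeuchi condition, seen in the
threefold tensor product. -/
theorem sandwichLeft_source_sweedlerComul (r : cent ι) (u : TSq ι) :
    sandwichLeft ι ((stB ι).s r) (sandwichRight ι 1 (sweedlerComul ι u)) =
      sandwichLeft ι 1 (sandwichRight ι ((stB ι).t (op r)) (sweedlerComul ι u)) := by
  rw [sandwichLeft_sandwichRight_sweedlerComul, sandwichLeft_sandwichRight_sweedlerComul]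
  congr 2
  refine Subtype.ext ?_
  change glue ι (tm ι 1 1) (tm ι 1 r) = glue ι (tm ι r 1) (tm ι 1 1)
  simp

theorem mem_takeuchi_of_tripleMap_eq (hinj : Function.Injective (tripleMap ι))
    {X : (stB ι).Tensor} {b : TSq ι} (hX : tripleMap ι X = sweedlerComul ι b) :
    X ∈ (stB ι).takeuchi := fun r => hinj <| by
  rw [tripleMap_legMul, tripleMap_legMul, hX, sandwichLeft_source_sweedlerComul]

/-! ### The coproduct and counit of `B`. -/

theorem coe_applyLeft (α : endBi ι) (b : tsqCent ι) :
    (applyLeft ι α b : TSq ι) = mapLeft ι α b := rfl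

/-- The map `x ⊗ y ⊗ z ↦ α(x) ⊗ y ⊗ z` for `α ∈ A`. -/
def mapLeft₃ (α : endBi ι) : TCube ι →+ TCube ι :=
  BalTensor.map (α.1 : M →+ M) (AddMonoidHom.id _) (fun n x => α.2.2 n x) (fun _ _ => rfl)

theorem mapLeft₃_tm₃ (α : endBi ι) (x : M) (u : TSq ι) :
    mapLeft₃ ι α (tm₃ ι x u) = tm₃ ι (α.1 x) u := rfl

theorem mapLeft₃_glue (α : endBi ι) (u v : TSq ι) :
    mapLeft₃ ι α (glue ι u v) = glue ι u (mapLeft ι α v) := by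
  induction v using tsq_induction with
  | h₀ => simp
  | ht x y => simp [mapLeft_tm, mapLeft₃_tm₃]
  | ha u v hu hv => simp only [map_add, hu, hv]

/-- The operator `α` acts on the first factor only, and the coproduct leaves that factor alone.
Coassociativity rests on this. -/
theorem mapLeft₃_sweedlerComul (α : endBi ι) (u : TSq ι) :
    mapLeft₃ ι α (sweedlerComul ι u) = sweedlerComul ι (mapLeft ι α u) := by
  induction u using tsq_induction with
  | h₀ => simp
  | ht x y => simp [mapLeft_tm, mapLeft₃_tm₃]
  | ha u v hu hv => simp only [map_add, hu, hv]

/-- The coproduct `b ↦ ∑ᵢ bᵢ ⊗ βᵢ(b¹) ⊗ b²` of `B` defined by families `bᵢ ∈ B`, `βᵢ ∈ A`. -/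
def comulB {k : ℕ} (b : Fin k → tsqCent ι) (β : Fin k → endBi ι) :
    tsqCent ι →+ (stB ι).Tensor where
  toFun x := ∑ i, BalTensor.tmul (stB ι).ra (stB ι).la (b i) (applyLeft ι (β i) x)
  map_zero' := Finset.sum_eq_zero fun i _ => by
    rw [show applyLeft ι (β i) 0 = 0 from Subtype.ext (map_zero (mapLeft ι (β i)))]
    exact map_zero (AddMonoidHom.mk' (BalTensor.tmul (stB ι).ra (stB ι).la (b i))
      (BalTensor.tmul_add (b i)))
  map_add' x y := by
    rw [← Finset.sum_add_distrib]
    refine Finset.sum_congr rfl fun i _ => ?_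
    rw [show applyLeft ι (β i) (x + y) = applyLeft ι (β i) x + applyLeft ι (β i) y from
      Subtype.ext (map_add (mapLeft ι (β i)) x.1 y.1), BalTensor.tmul_add]

theorem comulB_apply {k : ℕ} (b : Fin k → tsqCent ι) (β : Fin k → endBi ι) (x : tsqCent ι) :
    comulB ι b β x =
      ∑ i, BalTensor.tmul (stB ι).ra (stB ι).la (b i) (applyLeft ι (β i) x) := rfl

theorem contractLeft_sweedlerComul (α : endBi ι) (u : TSq ι) :
    contractLeft ι α (sweedlerComul ι u) = mapLeft ι α u := by
  induction u using tsq_induction with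
  | h₀ => simp
  | ht x y => simp [mapLeft_tm]
  | ha u v hu hv => simp only [map_add, hu, hv]

/-- The map `x ⊗ y ⊗ z ↦ x y ⊗ z`. -/
def counitLeft : TCube ι →+ TSq ι :=
  BalTensor.lift (fun x u => lmul ι x u) (fun _ _ _ => lmul_add ι _ _ _)
    (fun _ _ _ => map_add _ _ _) (fun n x u => (lmul_lmul ι x (ι n) u).symm)

@[simp] theorem counitLeft_tm₃ (x : M) (u : TSq ι) : counitLeft ι (tm₃ ι x u) = lmul ι x u := rfl

theorem counitLeft_glue (u v : TSq ι) :
    counitLeft ι (glue ι u v) = lmul ι (sweedlerCounit ι v) u := by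
  induction v using tsq_induction with
  | h₀ => simpa using (map_zero (AddMonoidHom.mk' (fun m => lmul ι m u)
      (fun m m' => lmul_add ι m m' u))).symm
  | ht x y => simp [lmul_lmul]
  | ha a b ha hb => simp only [map_add, ha, hb, lmul_add]

theorem counitLeft_sweedlerComul (u : TSq ι) : counitLeft ι (sweedlerComul ι u) = u := by
  induction u using tsq_induction with
  | h₀ => simp
  | ht x y => simp
  | ha u v hu hv => simp only [map_add, hu, hv]

/-- The map `x ⊗ y ⊗ z ↦ x ⊗ y z`. -/
def counitRight : TCube ι →+ TSq ι :=
  BalTensor.map (AddMonoidHom.id M) (sweedlerCounit ι) (fun _ _ => rfl)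
    (fun n u => sweedlerCounit_lmul ι (ι n) u)

@[simp] theorem counitRight_tm₃ (x : M) (u : TSq ι) :
    counitRight ι (tm₃ ι x u) = tm ι x (sweedlerCounit ι u) := rfl

theorem counitRight_glue (u v : TSq ι) :
    counitRight ι (glue ι u v) = rmul ι (sweedlerCounit ι u) v := by
  induction v using tsq_induction with
  | h₀ => simp
  | ht x y => simp [sweedlerCounit_lmul]
  | ha u v hu hv => simp only [map_add, hu, hv]

theorem counitRight_sweedlerComul (u : TSq ι) : counitRight ι (sweedlerComul ι u) = u := by
  induction u using tsq_induction with
  | h₀ => simp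
  | ht x y => simp
  | ha u v hu hv => simp only [map_add, hu, hv]

/-- Identifies `ε ⊗ id` with multiplying the first two factors of `M ⊗_N M ⊗_N M`, so that the
counit law can be read off there. -/
theorem coe_lift_la_counitB (h₁ h₂ h₃) (X : (stB ι).Tensor) :
    (((BalTensor.lift (fun c c' => (stB ι).la (counitB ι c) c') h₁ h₂ h₃ :
      (stB ι).Tensor →+ tsqCent ι) X : tsqCent ι) : TSq ι) = counitLeft ι (tripleMap ι X) := by
  induction X using BalTensor.induction with
  | h₀ => simp only [map_zero, ZeroMemClass.coe_zero]
  | ht c c' =>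
    rw [BalTensor.lift_tmul, tripleMap_tmul, stB_la, counitLeft_glue, coe_counitB]
  | ha u v hu hv => simp only [map_add, AddSubgroup.coe_add, hu, hv]

theorem coe_lift_ra_counitB (h₁ h₂ h₃) (X : (stB ι).Tensor) :
    (((BalTensor.lift (fun c c' => (stB ι).ra (counitB ι c') c) h₁ h₂ h₃ :
      (stB ι).Tensor →+ tsqCent ι) X : tsqCent ι) : TSq ι) = counitRight ι (tripleMap ι X) := by
  induction X using BalTensor.induction with
  | h₀ => simp only [map_zero, ZeroMemClass.coe_zero]
  | ht c c' =>
    rw [BalTensor.lift_tmul, tripleMap_tmul, stB_ra, counitRight_glue, coe_counitB]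
  | ha u v hu hv => simp only [map_add, AddSubgroup.coe_add, hu, hv]

/-- Since `ε(c u) = u¹ c¹ c² u²`, only `ε(c)` matters, and `t(ε(c))` is an element with the same
counit. Both multiplicative counit axioms follow, as `ε ∘ s` and `ε ∘ t` are the identity on `R`. -/
theorem sweedlerCounit_sandwich (c : tsqCent ι) (u : TSq ι) :
    sweedlerCounit ι (sandwich ι c u) =
      sweedlerCounit ι (sandwich ι ((stB ι).t (op (counitB ι c))) u) := by
  induction u using tsq_induction with
  | h₀ => simp
  | ht x y =>
    rw [sandwich_tm, sandwich_tm, stB_t]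
    simp [sweedlerCounit_lmul, sweedlerCounit_rmul, mul_assoc]
  | ha u v hu hv => simp only [map_add, hu, hv]

theorem counitB_mul_eq_of_counitB_eq {c d : tsqCent ι} (h : counitB ι c = counitB ι d)
    (a : tsqCent ι) : counitB ι (c * a) = counitB ι (d * a) := Subtype.ext <| by
  change sweedlerCounit ι (sandwich ι c a) = sweedlerCounit ι (sandwich ι d a)
  rw [sweedlerCounit_sandwich ι c, sweedlerCounit_sandwich ι d, h]

theorem counitB_source (r : cent ι) : counitB ι ((stB ι).s r) = r :=
  Subtype.ext (one_mul (r : M))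

theorem counitB_target (r : cent ι) : counitB ι ((stB ι).t (op r)) = r :=
  Subtype.ext (mul_one (r : M))

/-! ### The bialgebroid axioms. -/

variable {ι} {k : ℕ} {b : Fin k → tsqCent ι} {β : Fin k → endBi ι}

/-- Contracting `x¹ ⊗ 1 ⊗ x²` by `βᵢ` gives `βᵢ(x¹) ⊗ x²`, so this is `sum_glue` at the Sweedler
coproduct. The right side does not mention the quasibasis, hence neither does `Δ_B` up to equality.
-/
theorem IsLeftD2Quasibasis.tripleMap_comulB (h : IsLeftD2Quasibasis ι b β) (x : tsqCent ι) :
    tripleMap ι (comulB ι b β x) = sweedlerComul ι (x : TSq ι) := by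
  rw [comulB_apply, map_sum]
  simp only [tripleMap_tmul, coe_applyLeft, ← contractLeft_sweedlerComul]
  exact h.sum_glue _

/-- Both sides expand to the double sum of `bⱼ ⊗ (βⱼ(bᵢ¹) ⊗ bᵢ²) ⊗ (βᵢ(x¹) ⊗ x²)`. -/
theorem IsLeftD2Quasibasis.coassoc (h : IsLeftD2Quasibasis ι b β)
    (hra : ∀ (r : cent ι) (a : tsqCent ι),
      comulB ι b β ((stB ι).ra r a) = (stB ι).tensorRa r (comulB ι b β a))
    (hla : ∀ (r : cent ι) (a : tsqCent ι),
      comulB ι b β ((stB ι).la r a) = (stB ι).tensorLa r (comulB ι b β a)) (x : tsqCent ι) :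
    (stB ι).assoc ((BalTensor.map (ra' := (stB ι).tensorRa) (la' := (stB ι).la)
        (comulB ι b β) (AddMonoidHom.id (tsqCent ι)) hra (fun _ _ => rfl)) (comulB ι b β x)) =
      (BalTensor.map (ra' := (stB ι).ra) (la' := (stB ι).tensorLa)
        (AddMonoidHom.id (tsqCent ι)) (comulB ι b β) (fun _ _ => rfl) hla) (comulB ι b β x) := by
  -- This says `(βⱼ ⊗ id) Δ(x) = Δ(βⱼ(x¹) ⊗ x²)`, an identity in the twofold product `B ⊗_R B`,
  -- where injectivity of `tripleMap` applies.
  have key : ∀ j, ∑ i, BalTensor.tmul (stB ι).ra (stB ι).la (applyLeft ι (β j) (b i))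
      (applyLeft ι (β i) x) = comulB ι b β (applyLeft ι (β j) x) := fun j => by
    refine h.tripleMap_injective ?_
    rw [h.tripleMap_comulB, coe_applyLeft, ← mapLeft₃_sweedlerComul, ← h.tripleMap_comulB,
      comulB_apply, map_sum, map_sum, map_sum]
    simp only [tripleMap_tmul, mapLeft₃_glue, coe_applyLeft]
  rw [comulB_apply ι b β x, map_sum, map_sum, map_sum]
  simp only [BalTensor.map_tmul, AddMonoidHom.id_apply]
  simp only [← key]
  have hL : ∀ i, (stB ι).assoc (BalTensor.tmul (stB ι).tensorRa (stB ι).la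
      (comulB ι b β (b i)) (applyLeft ι (β i) x)) =
      ∑ j, BalTensor.tmul (stB ι).ra (stB ι).tensorLa (b j)
        (BalTensor.tmul (stB ι).ra (stB ι).la (applyLeft ι (β j) (b i))
          (applyLeft ι (β i) x)) := fun i => by
    have := map_sum ((stB ι).assoc.comp (AddMonoidHom.mk'
      (fun X => BalTensor.tmul (stB ι).tensorRa (stB ι).la X (applyLeft ι (β i) x))
      (fun X Y => BalTensor.add_tmul X Y _)))
      (fun j => BalTensor.tmul (stB ι).ra (stB ι).la (b j) (applyLeft ι (β j) (b i))) Finset.univ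
    exact this
  have hR : ∀ j, BalTensor.tmul (stB ι).ra (stB ι).tensorLa (b j)
      (∑ i, BalTensor.tmul (stB ι).ra (stB ι).la (applyLeft ι (β j) (b i))
        (applyLeft ι (β i) x)) =
      ∑ i, BalTensor.tmul (stB ι).ra (stB ι).tensorLa (b j)
        (BalTensor.tmul (stB ι).ra (stB ι).la (applyLeft ι (β j) (b i))
          (applyLeft ι (β i) x)) := fun j =>
    map_sum (AddMonoidHom.mk' (BalTensor.tmul (stB ι).ra (stB ι).tensorLa (b j))
      (BalTensor.tmul_add (b j))) _ _
  simp only [hL, hR]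
  exact Finset.sum_comm

theorem IsLeftD2Quasibasis.comulB_la (h : IsLeftD2Quasibasis ι b β) (r : cent ι) (a : tsqCent ι) :
    comulB ι b β ((stB ι).la r a) = (stB ι).tensorLa r (comulB ι b β a) :=
  h.tripleMap_injective <| by
    rw [tripleMap_tensorLa, h.tripleMap_comulB, h.tripleMap_comulB, stB_la, sweedlerComul_lmul]

theorem IsLeftD2Quasibasis.comulB_ra (h : IsLeftD2Quasibasis ι b β) (r : cent ι) (a : tsqCent ι) :
    comulB ι b β ((stB ι).ra r a) = (stB ι).tensorRa r (comulB ι b β a) :=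
  h.tripleMap_injective <| by
    rw [tripleMap_tensorRa, h.tripleMap_comulB, h.tripleMap_comulB, stB_ra, sweedlerComul_rmul]

/-- The coproduct of `B` as a ring homomorphism `B → B ×_R B`. -/
def IsLeftD2Quasibasis.comulHom (h : IsLeftD2Quasibasis ι b β) :
    tsqCent ι →+* (stB ι).takeuchi where
  toFun x := ⟨comulB ι b β x,
    mem_takeuchi_of_tripleMap_eq ι h.tripleMap_injective (h.tripleMap_comulB x)⟩
  map_one' := Subtype.ext <| h.tripleMap_injective <| by
    rw [h.tripleMap_comulB, SourceTarget.takeuchi_coe_one, tripleMap_tmul, tsqCent_coe_one]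
    simp
  -- Both sides map to `y¹ x¹ ⊗ 1 ⊗ x² y²`: the product `Δ(x) Δ(y)` becomes `y¹ (x¹ ⊗ 1 ⊗ x²) y²`.
  map_mul' x y := Subtype.ext <| h.tripleMap_injective <| by
    rw [h.tripleMap_comulB, SourceTarget.takeuchi_coe_mul,
      tripleMap_mulT ι _ y (h.tripleMap_comulB y), tsqCent_coe_mul,
      ← cubeSandwich_sweedlerComul]
    congr 2
    exact Subtype.ext (h.tripleMap_comulB x).symm
  map_zero' := Subtype.ext (map_zero (comulB ι b β))
  map_add' x y := Subtype.ext (map_add (comulB ι b β) x y)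

/-- The right bialgebroid `B` over `R` of an extension with a left D2 quasibasis. -/
def IsLeftD2Quasibasis.bialgebroid (h : IsLeftD2Quasibasis ι b β) :
    RightBialgebroid (stB ι) where
  comul := h.comulHom
  counit := counitB ι
  comul_la := h.comulB_la
  comul_ra := h.comulB_ra
  counit_la r a := Subtype.ext <| by
    rw [coe_counitB, stB_la, sweedlerCounit_lmul]; rfl
  counit_ra r a := Subtype.ext <| by
    rw [coe_counitB, stB_ra, sweedlerCounit_rmul]; rfl
  coassoc := h.coassoc h.comulB_ra h.comulB_la
  counit_comul a := Subtype.ext <| by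
    refine (coe_lift_la_counitB ι _ _ _ _).trans ?_
    exact (congrArg (counitLeft ι) (h.tripleMap_comulB a)).trans (counitLeft_sweedlerComul ι _)
  comul_counit a := Subtype.ext <| by
    refine (coe_lift_ra_counitB ι _ _ _ _).trans ?_
    exact (congrArg (counitRight ι) (h.tripleMap_comulB a)).trans (counitRight_sweedlerComul ι _)
  counit_one := Subtype.ext (one_mul (1 : M))
  counit_target_mul a c := counitB_mul_eq_of_counitB_eq ι (counitB_target ι _) c
  counit_source_mul a c := counitB_mul_eq_of_counitB_eq ι (counitB_source ι _) c

end Comul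

/-! ### The module algebroid `End _N M` -/

section ModuleAlgebroid

variable {N M : Type*} [Ring N] [Ring M] (ι : N →+* M)

theorem endAct_apply (ξ : endLeft ι) (b : tsqCent ι) (x : M) :
    (endAct ι ξ b).1 x = evalAct ι ξ x b := rfl

variable {ι} in
theorem endLeft_ext {ξ η : endLeft ι} (h : ∀ x, ξ.1 x = η.1 x) : ξ = η :=
  Subtype.ext (AddMonoidHom.ext h)

theorem endLeft_add_apply (ξ η : endLeft ι) (x : M) : (ξ + η).1 x = ξ.1 x + η.1 x := rfl

theorem endLeft_mul_apply (ξ η : endLeft ι) (x : M) : (ξ * η).1 x = ξ.1 (η.1 x) := rfl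

theorem evalAct_lmul (ξ : endLeft ι) (x m : M) (u : TSq ι) :
    evalAct ι ξ x (lmul ι m u) = m * evalAct ι ξ x u := by
  induction u using tsq_induction with
  | h₀ => simp
  | ht a a' => simp [mul_assoc]
  | ha u v hu hv => simp only [map_add, hu, hv, mul_add]

theorem evalAct_rmul (ξ : endLeft ι) (x m : M) (u : TSq ι) :
    evalAct ι ξ x (rmul ι m u) = evalAct ι ξ (m * x) u := by
  induction u using tsq_induction with
  | h₀ => simp
  | ht a a' => simp [mul_assoc]
  | ha u v hu hv => simp only [map_add, hu, hv]

/-- Associativity of the action: `b u = u¹ b¹ ⊗ b² u²` gives `u¹ b¹ ξ(b² u² x)`, which is `(ξ ◁ b) ◁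
u` at `x`. -/
theorem evalAct_sandwich (ξ : endLeft ι) (b : tsqCent ι) (x : M) (u : TSq ι) :
    evalAct ι ξ x (sandwich ι b u) = evalAct ι (endAct ι ξ b) x u := by
  induction u using tsq_induction with
  | h₀ => simp
  | ht a a' => rw [sandwich_tm, evalAct_lmul, evalAct_rmul, evalAct_tm, endAct_apply]
  | ha u v hu hv => simp only [map_add, hu, hv]

/-- The right `B`-action `ξ ◁ b = b¹ ξ(b² -)` on `End _N M` as a ring homomorphism. -/
def endActHom : (tsqCent ι)ᵐᵒᵖ →+* AddMonoid.End (endLeft ι) where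
  toFun b := AddMonoidHom.mk' (fun ξ => endAct ι ξ (unop b)) fun ξ η => endLeft_ext fun x => by
    rw [endLeft_add_apply, endAct_apply, endAct_apply, endAct_apply]
    refine DFunLike.congr_fun (g := evalAct ι ξ x + evalAct ι η x)
      (tsq_hom_ext fun a a' => ?_) (unop b).1
    exact mul_add a (ξ.1 (a' * x)) (η.1 (a' * x))
  map_one' := AddMonoidHom.ext fun ξ => endLeft_ext fun x => by
    change (1 : M) * ξ.1 (1 * x) = ξ.1 x
    rw [one_mul, one_mul]
  map_mul' b b' := AddMonoidHom.ext fun ξ => endLeft_ext fun x =>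
    evalAct_sandwich ι ξ (unop b') x (unop b).1
  map_zero' := AddMonoidHom.ext fun ξ => endLeft_ext fun x => map_zero (evalAct ι ξ x)
  map_add' b b' := AddMonoidHom.ext fun ξ => endLeft_ext fun x =>
    map_add (evalAct ι ξ x) (unop b).1 (unop b').1

theorem endActHom_op (b : tsqCent ι) (ξ : endLeft ι) : endActHom ι (op b) ξ = endAct ι ξ b := rfl

theorem endAct_source (ξ : endLeft ι) (r : cent ι) (x : M) :
    (endAct ι ξ ((stB ι).s r)).1 x = ξ.1 (r * x) :=
  one_mul (ξ.1 (r * x))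

theorem endAct_target (ξ : endLeft ι) (r : cent ι) (x : M) :
    (endAct ι ξ ((stB ι).t (op r))).1 x = r * ξ.1 x := by
  change (r : M) * ξ.1 (1 * x) = r * ξ.1 x
  rw [one_mul]

/-- The map `x ⊗ y ⊗ z ↦ x ξ(y η(z m))` on `M ⊗_N M ⊗_N M`. -/
def evalAct₃ (ξ η : endLeft ι) (m : M) : TCube ι →+ M :=
  BalTensor.lift (fun x u => x * ξ.1 (evalAct ι η m u)) (fun _ _ _ => add_mul _ _ _)
    (fun _ _ _ => by rw [map_add, map_add, mul_add])
    (fun n x u => by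
      rw [evalAct_lmul, endLeft_map, AddMonoidHom.mulRight_apply, mul_assoc])

@[simp] theorem evalAct₃_tm₃ (ξ η : endLeft ι) (m x : M) (u : TSq ι) :
    evalAct₃ ι ξ η m (tm₃ ι x u) = x * ξ.1 (evalAct ι η m u) := rfl

theorem evalAct₃_sweedlerComul (ξ η : endLeft ι) (m : M) (u : TSq ι) :
    evalAct₃ ι ξ η m (sweedlerComul ι u) = evalAct ι (ξ * η) m u := by
  induction u using tsq_induction with
  | h₀ => simp
  | ht x y => simp
  | ha u v hu hv => simp only [map_add, hu, hv]

theorem evalAct₃_glue (ξ η : endLeft ι) (m : M) (b : tsqCent ι) (u : TSq ι) :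
    evalAct₃ ι ξ η m (glue ι (b : TSq ι) u) = evalAct ι ξ ((endAct ι η b).1 m) u := by
  induction u using tsq_induction with
  | h₀ => simp
  | ht x y => rw [glue_tm, evalAct₃_tm₃, evalAct_lmul, evalAct_tm, endAct_apply]
  | ha u v hu hv => simp only [map_add, hu, hv]

/-- The value `c¹ ξ(c² c'¹ η(c'² m))` sees `c ⊗ c'` only through `c¹ ⊗ c² c'¹ ⊗ c'²`. -/
theorem lift_endAct_mul_apply (ξ η : endLeft ι) (m : M) (h₁ h₂ h₃) (X : (stB ι).Tensor) :
    ((BalTensor.lift (fun c c' => endActHom ι (op c) ξ * endActHom ι (op c') η) h₁ h₂ h₃ :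
      (stB ι).Tensor →+ endLeft ι) X).1 m = evalAct₃ ι ξ η m (tripleMap ι X) := by
  induction X using BalTensor.induction with
  | h₀ => simp only [map_zero]; rfl
  | ht c c' =>
    rw [BalTensor.lift_tmul, tripleMap_tmul, evalAct₃_glue, endLeft_mul_apply]
    rfl
  | ha u v hu hv => rw [map_add, map_add, map_add, endLeft_add_apply, hu, hv]

theorem evalAct_rho (m x : M) (u : TSq ι) :
    evalAct ι (rho ι (op m)) x u = sweedlerCounit ι u * x * m := by
  induction u using tsq_induction with
  | h₀ => simp
  | ht a a' =>
    change a * (a' * x * m) = a * a' * x * m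
    simp only [mul_assoc]
  | ha u v hu hv => simp only [map_add, hu, hv, add_mul]

/-- Right multiplications commute with left multiplications, so `b¹ (b² x m) = ε(b) x m` depends on
`b` only through `ε(b)`. -/
theorem endAct_rho (m : M) (b : tsqCent ι) :
    endAct ι (rho ι (op m)) b = endAct ι (rho ι (op m)) ((stB ι).s (counitB ι b)) :=
  endLeft_ext fun x => by
    rw [endAct_source, endAct_apply, evalAct_rho]
    rfl

variable {ι}

/-- The module algebroid `End _N M` over the bialgebroid `B`. -/
def IsLeftD2Quasibasis.moduleAlgebroid {k : ℕ} {b : Fin k → tsqCent ι} {β : Fin k → endBi ι}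
    (h : IsLeftD2Quasibasis ι b β) : RightModuleAlgebroid h.bialgebroid (endLeft ι) where
  act := endActHom ι
  act_source_mul r ξ η := endLeft_ext fun x => by
    rw [endActHom_op, endActHom_op, endLeft_mul_apply, endLeft_mul_apply, endAct_source,
      endAct_target]
  act_target_mul r ξ η := endLeft_ext fun x => by
    rw [endActHom_op, endActHom_op, endLeft_mul_apply, endAct_target, endAct_target,
      endLeft_mul_apply]
  mul_act_source r ξ η := endLeft_ext fun x => by
    rw [endActHom_op, endActHom_op, endLeft_mul_apply, endAct_source, endAct_source,
      endLeft_mul_apply]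
  -- On `a¹ ⊗ 1 ⊗ a²` the evaluation `x ξ(y η(z m))` collapses to `a¹ ξ(η(a² m))`.
  mul_act a ξ η := endLeft_ext fun m => by
    refine Eq.trans ?_ (lift_endAct_mul_apply ι ξ η m _ _ _ _).symm
    refine Eq.trans ?_ (congrArg (evalAct₃ ι ξ η m) (h.tripleMap_comulB a)).symm
    rw [evalAct₃_sweedlerComul]
    rfl
  one_act_target r := endLeft_ext fun x => by
    rw [endActHom_op, endActHom_op, endAct_source, endAct_target]
    rfl
  -- The unit of `End _N M` is `ρ(1)`, hence an invariant.
  one_act a := by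
    have h₁ : rho ι (op 1) = 1 := map_one (rho ι)
    rw [← h₁]
    exact endAct_rho ι 1 a

/-- The candidate is `m = ξ(1)`. The right quasibasis writes `1 ⊗ m` through elements of `B`, on
which invariance determines `b¹ ξ(b²)`. -/
theorem IsRightD2.mem_range_rho (h : IsRightD2 ι) {ξ : endLeft ι}
    (hξ : ∀ b : tsqCent ι, endAct ι ξ b = endAct ι ξ ((stB ι).s (counitB ι b))) :
    ξ ∈ (rho ι).range := by
  obtain ⟨k, c, γ, hc⟩ := h.exists_quasibasis
  -- Invariance under `t(r)`, evaluated at `1`, gives linearity of `ξ` over `R`; it is needed to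
  -- pull `ε(b)` out of `ξ` in `hB`.
  have hR : ∀ r : cent ι, ξ.1 r = r * ξ.1 1 := fun r => by
    have := congrArg (fun η : endLeft ι => η.1 1) (hξ ((stB ι).t (op r)))
    simp only [endAct_source, endAct_target, counitB_target, mul_one] at this
    exact this.symm
  have hB : ∀ b : tsqCent ι, evalAct ι ξ 1 (b : TSq ι) = sweedlerCounit ι b * ξ.1 1 := fun b => by
    have := congrArg (fun η : endLeft ι => η.1 1) (hξ b)
    simp only [endAct_source, mul_one, hR] at this
    exact this
  refine ⟨op (ξ.1 1), endLeft_ext fun m => ?_⟩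
  -- Applying `x ⊗ y ↦ x ξ(y)` to the quasibasis identity gives `∑ γⱼ(m) ε(cⱼ) ξ(1) = ξ(m)`;
  -- applying multiplication gives `∑ γⱼ(m) ε(cⱼ) = m`.
  have h₁ := congrArg (evalAct ι ξ 1) (hc m)
  have h₂ := congrArg (sweedlerCounit ι) (hc m)
  simp only [map_sum, evalAct_lmul, hB, evalAct_tm, one_mul, mul_one] at h₁
  simp only [map_sum, sweedlerCounit_lmul, sweedlerCounit_tm, one_mul] at h₂
  rw [← h₁]
  simp only [← mul_assoc, ← Finset.sum_mul, h₂]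
  rfl

end ModuleAlgebroid

end DepthTwo

open DepthTwo
theorem mainTheorem3 {N M : Type*} [Ring N] [Ring M] (ι : N →+* M) (hD2 : IsD2 ι) :
    -- `B ⊗_R B → (M ⊗_N M ⊗_N M)^N` is an isomorphism of `R`-`R`-bimodules
    (Function.Injective (tripleMap ι) ∧ (tripleMap ι).range = tcubeCent ι ∧
      (∀ (r : cent ι) (x : (stB ι).Tensor),
        tripleMap ι ((stB ι).tensorLa r x) = lmul₃ ι r (tripleMap ι x)) ∧
      (∀ (r : cent ι) (x : (stB ι).Tensor),
        tripleMap ι ((stB ι).tensorRa r x) = rmul₃ ι r (tripleMap ι x))) ∧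
    -- left D2 quasibases exist
    (∃ (k : ℕ) (b : Fin k → tsqCent ι) (β : Fin k → endBi ι), IsLeftD2Quasibasis ι b β) ∧
    -- `B` is a right bialgebroid over `R`
    ∃ 𝓑 : RightBialgebroid (stB ι),
      (∀ b : tsqCent ι,
        tripleMap ι (𝓑.comul b : (stB ι).Tensor) = sweedlerComul ι (b : TSq ι)) ∧
      (∀ (k : ℕ) (b : Fin k → tsqCent ι) (β : Fin k → endBi ι), IsLeftD2Quasibasis ι b β →
        ∀ x : tsqCent ι, (𝓑.comul x : (stB ι).Tensor) =
          ∑ i, BalTensor.tmul (stB ι).ra (stB ι).la (b i) (applyLeft ι (β i) x)) ∧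
      (∀ b : tsqCent ι, (𝓑.counit b : M) = sweedlerCounit ι (b : TSq ι)) ∧
      -- `End _N M` is a right `B`-module algebroid with invariants `ρ(M)`
      ∃ 𝓜 : RightModuleAlgebroid 𝓑 (endLeft ι),
        (∀ (ξ : endLeft ι) (b : tsqCent ι), 𝓜.act (op b) ξ = endAct ι ξ b) ∧
        𝓜.invariants = ((rho ι).range : Set (endLeft ι)) := by
  obtain ⟨k, b, β, h⟩ := hD2.1.exists_quasibasis
  refine ⟨⟨h.tripleMap_injective, h.range_tripleMap, tripleMap_tensorLa ι, tripleMap_tensorRa ι⟩,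
    ⟨k, b, β, h⟩, h.bialgebroid, h.tripleMap_comulB, fun k' b' β' h' x => ?_, coe_counitB ι,
    h.moduleAlgebroid, fun ξ c => rfl, Set.Subset.antisymm (fun ξ hξ => ?_) ?_⟩
  -- Any other quasibasis defines a coproduct with the same image `x¹ ⊗ 1 ⊗ x²`, hence the same
  -- coproduct.
  · exact h.tripleMap_injective ((h.tripleMap_comulB x).trans (h'.tripleMap_comulB x).symm)
  · exact hD2.2.mem_range_rho hξ
  · rintro _ ⟨m, rfl⟩ c
    exact endAct_rho ι (unop m) c
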